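/- **Setting.** Let $S,A,N\ge 1$. A Wasserstein distributionally robust MDP has $S$ states, $A$ actions, costs $c\in\mathbb R^{S\times A}$, a discount factor $\lambda\in(0,1)$, a radius $\theta\ge 0$, a metric $d\in\{\ell_1,\ell_2,\ell_\infty\}$ on $\mathbb R^{A\times S}$, a type $p\in[1,\infty]$ and, for each state $s$, nominal kernels $\hat y_{1,s},\dots,\hat y_{N,s}\in\mathcal U=\Delta(S)^A$. Let $\nu_s=\frac1N\sum_i\delta_{\hat y_{i,s}}$, let $\mathbb D_s$ be the set of probability measures $\mu$ on $\mathcal U$ with $W_p(\mu,\nu_s)\le\theta$ ($W_p$ the type-$p$ Wasserstein distance for $d$), and $\mathbb B_s=\{\mathbb E_{y\sim\mu}[y]:\mu\in\mathbb D_s\}$. Put $F^{x,y}(v)_s=\sum_a x_{sa}(c_{sa}+\lambda y_{sa}^\top v)$, and let $v^*$ solve the Bellman equation $v^*_s=\min_{x\in\Delta(A)}\max_{\mu\in\mathbb D_s}\mathbb E_{y\sim\mu}\sum_a x_a(c_{sa}+\lambda y_a^\top v^*)$ for all $s$. The duality gap of a pair $(x,y)$ is $$\max_s\Big\{\max_{y'\in\mathbb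 B_s}F^{x,y'}(v^*)_s-\min_{x'\in\Delta(A)}F^{x',y}(v^*)_s\Big\}.$$ **Algorithm.** Let $Y_s=\{(y_i)_{i\le N}\in\mathcal U^N:\frac1N\sum_i d(y_i,\hat y_{i,s})^p\le\theta^p\}$ (for $p=\infty$: $d(y_i,\hat y_{i,s})\le\theta$ for all $i$), $D_X(x,x')=\frac12\|x-x'\|_2^2$ and $D_Y((y_i),(y_i'))=\sum_i\frac12\|y_i-y_i'\|_2^2$. Start from any $v^1\in\mathbb R^S$, $x^0_s\in\Delta(A)$, $(y^0_{i,s})_i\in Y_s$. Epoch $\ell=1,2,\dots$ consists of the $\ell^2$ iterations $t=t_\ell,\dots,t_\ell+\ell^2-1$, where $t_\ell=\sum_{j<\ell}j^2$, with step sizes $\tau_\ell=(\sqrt A\lambda\|v^\ell\|_2)^{-1}$, $\sigma_\ell=N\sqrt A(\lambda\|v^\ell\|_2)^{-1}$; in every state $s$, $$x^{t+1}_s=\arg\min_{x\in\Delta(A)}\tau_\ell\sum_a x_a\Big(c_{sa}+\tfrac{\lambda}{N}\sum_i (y^{t}_{i,sa})^{\top}v^\ell\Big)+D_X(x,x^t_s),$$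 $$(y^{t+1}_{i,s})_i=\arg\max_{(y_i)\in Y_s}\sigma_\ell\tfrac{\lambda}{N}\sum_{i,a}(2x^{t+1}_{sa}-x^t_{sa})\,y_{i,a}^\top v^\ell-D_Y((y_i),(y^t_{i,s})).$$ At the end of the epoch, $v^{\ell+1}_s=F^{\bar x^\ell,\bar y^\ell}(v^\ell)_s$, where $\bar x^\ell$, $\bar y^\ell_i$ are the averages of the iterates $t_\ell+1,\dots,t_\ell+\ell^2$ with weights proportional to $t$ and $\bar y^\ell=\frac1N\sum_i\bar y^\ell_i$. The output after $T$ iterations is the pair $\bar x^T$, $\bar y^T=\frac1N\sum_i\bar y^T_i$, where $\bar x^T,\bar y^T_i$ are the averages of the iterates $1,\dots,T$ with weights proportional to $t$. Assume $v^\ell\ne 0$ for all $\ell\ge 1$, so that the step sizes are defined. Let $R_X=\max_{x\in\Delta(A)}\|x\|_2$, $R_Y=\max_s\max_{y\in Y_s}\|y\|_2$, and let $\Theta_X$, $\Theta_Y$ be the maxima of $D_X$ on $\Delta(A)^2$ and of $D_Y$ on $Y_s\times Y_s$ over all $s$. **Theorem 1.** There is a constant $C$, depending only on $\lambda$ if $A\ge2$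 and only on $\lambda,\theta$ if $A=1$, such that for every such MDP and every run of the algorithm: (i) for all $T\ge1$, the duality gap of $(\bar x^T,\bar y^T)$ is at most $$C\,\frac{\sqrt S}{\sqrt N}\,R_XR_Y\,\sup_{\ell}\Big(\frac{\Theta_X}{\tau_\ell}+\frac{\Theta_Y}{\sigma_\ell}\Big)\,T^{-2/3},$$ with the supremum over all epochs $\ell\ge1$ of the run; (ii) for all sufficiently large $T$ (depending on the run), the same bound holds with the supremum over only those epochs $\ell\ge1$ with $t_\ell<T$, i.e. those started within the first $T$ iterations. -/

import Mathlib

noncomputable section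

open MeasureTheory
open scoped ENNReal

namespace WDRMDP

/-- Transition parameters out of one state: `y a s'` is the probability of moving to `s'`
under action `a` (when `y` lies in `kernels`). -/
abbrev Kern (S A : ℕ) : Type := Fin A → Fin S → ℝ

/-- `𝒰 = Δ(S)^A`, as a subset of `ℝ^{A × S}`. -/
def kernels (S A : ℕ) : Set (Kern S A) := {y | ∀ a, y a ∈ stdSimplex ℝ (Fin S)}

/-- The three base metrics on `ℝ^{A × S}`. -/
inductive BaseMetric : Type where
  | l1 : BaseMetric
  | l2 : BaseMetric
  | linf : BaseMetric

/-- The distance on `ℝ^{A × S}` (all `A * S` coordinates together) induced by the `ℓ₁`, `ℓ₂` or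
`ℓ_∞` norm. The norm of a function type used for `linf` is the sup norm. -/
def BaseMetric.d {S A : ℕ} : BaseMetric → Kern S A → Kern S A → ℝ
  | .l1, y, z => ∑ a, ∑ s', |y a s' - z a s'|
  | .l2, y, z => Real.sqrt (∑ a, ∑ s', (y a s' - z a s') ^ 2)
  | .linf, y, z => ‖y - z‖

/-- The type-`p` Wasserstein distance, `1 ≤ p ≤ ∞`: the infimum over all couplings `κ` of the
`L^p(κ)` norm of the base distance (the `κ`-essential supremum when `p = ∞`). -/
def wasserstein {S A : ℕ} (m : BaseMetric) (p : ℝ≥0∞) (μ ν : Measure (Kern S A)) : ℝ≥0∞ :=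
  ⨅ κ : {κ : Measure (Kern S A × Kern S A) //
      κ.map Prod.fst = μ ∧ κ.map Prod.snd = ν},
    eLpNorm (fun z : Kern S A × Kern S A => m.d z.1 z.2) p κ.1

/-- A Wasserstein distributionally robust MDP with `S` states, `A` actions and, in every state,
`N` nominal kernels. -/
structure Model (S A N : ℕ) where
  /-- state-action costs -/
  cost : Fin S → Fin A → ℝ
  /-- discount factor -/
  disc : ℝ
  disc_pos : 0 < disc
  disc_lt_one : disc < 1
  /-- nominal kernels: `nominal s i` is the `i`-th nominal kernel in state `s` -/
  nominal : Fin S → Fin N → Kern S A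
  nominal_mem : ∀ s i, nominal s i ∈ kernels S A
  /-- the metric underlying the Wasserstein distance -/
  metric : BaseMetric
  /-- the type of the Wasserstein distance, finite or infinite -/
  p : ℝ≥0∞
  one_le_p : 1 ≤ p
  /-- radius of the Wasserstein balls -/
  radius : ℝ
  radius_nonneg : 0 ≤ radius

variable {S A N : ℕ}

/-- The average `(1/N) ∑ᵢ yᵢ` of an `N`-tuple of kernels. -/
def meanKernel (y : Fin N → Kern S A) : Kern S A := (N : ℝ)⁻¹ • ∑ i, y i

/-- A weighted average of `z_{a+1}, …, z_b` with linear weights: `z_t` has weight proportional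
to `t`. -/
def linAvg {E : Type*} [AddCommGroup E] [Module ℝ E] (a b : ℕ) (z : ℕ → E) : E :=
  ∑ t ∈ Finset.Ioc a b, ((t : ℝ) / ∑ u ∈ Finset.Ioc a b, (u : ℝ)) • z t

/-- The Euclidean norm of a vector indexed by states. -/
def l2norm (v : Fin S → ℝ) : ℝ := Real.sqrt (∑ s, v s ^ 2)

/-- The number of iterations performed before epoch `ℓ`, epoch `j` having `j²` iterations:
`1² + ⋯ + (ℓ-1)²`. -/
def epochStart (ℓ : ℕ) : ℕ := ∑ j ∈ Finset.Ico 1 ℓ, j ^ 2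

namespace Model

variable (M : Model S A N)

/-! ### The robust Bellman equation -/

/-- `F^{x,y}(v)_s = ∑ₐ xₐ (c_{sa} + λ yₐᵀ v)`. -/
def eval (x : Fin A → ℝ) (y : Kern S A) (v : Fin S → ℝ) (s : Fin S) : ℝ :=
  ∑ a, x a * (M.cost s a + M.disc * ∑ s', y a s' * v s')

/-- The nominal distribution in state `s`: the uniform distribution on the nominal kernels. -/
def nominalMeasure (s : Fin S) : Measure (Kern S A) :=
  (N : ℝ≥0∞)⁻¹ • ∑ i, Measure.dirac (M.nominal s i)

/-- The ambiguity set in state `s`: the probability measures on `𝒰` in the Wasserstein ball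
around the nominal distribution. -/
def ambiguity (s : Fin S) : Set (Measure (Kern S A)) :=
  {μ | IsProbabilityMeasure μ ∧ μ (kernels S A)ᶜ = 0 ∧
    wasserstein M.metric M.p μ (M.nominalMeasure s) ≤ ENNReal.ofReal M.radius}

/-- The set of expected kernels of the measures in the ambiguity set. -/
def expectedKernels (s : Fin S) : Set (Kern S A) :=
  {y | ∃ μ ∈ M.ambiguity s, y = ∫ z, z ∂μ}

/-- `v` solves the robust Bellman equation
`v_s = min_{x ∈ Δ(A)} max_{μ ∈ 𝔻_s} 𝔼_{y ∼ μ} ∑ₐ xₐ (c_{sa} + λ yₐᵀ v)`, `s` any state, with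
both extrema attained. -/
def IsValueVector (v : Fin S → ℝ) : Prop :=
  ∀ s, IsLeast
    {r | ∃ x ∈ stdSimplex ℝ (Fin A),
      IsGreatest ((fun μ : Measure (Kern S A) => ∫ y, M.eval x y v s ∂μ) '' M.ambiguity s) r}
    (v s)

/-- The duality gap, for the value vector `v`, of a policy `x` and kernels `y`:
`max_s (max_{y' ∈ 𝔹_s} F^{x,y'}(v)_s - min_{x' ∈ Δ(A)} F^{x',y}(v)_s)`. -/
def dualityGap (v : Fin S → ℝ) (x : Fin S → Fin A → ℝ) (y : Fin S → Kern S A) : ℝ :=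
  ⨆ s, (sSup ((fun y' => M.eval (x s) y' v s) '' M.expectedKernels s) -
    sInf ((fun x' => M.eval x' (y s) v s) '' stdSimplex ℝ (Fin A)))

/-! ### Euclidean proximal setup -/

/-- The decision set of the maximizing player in state `s`: the `N`-tuples of kernels with
`(1/N) ∑ᵢ d(yᵢ, ŷᵢ)^p ≤ θ^p` (with `d(yᵢ, ŷᵢ) ≤ θ` for all `i` if `p = ∞`). -/
def tuples (s : Fin S) : Set (Fin N → Kern S A) :=
  {y | (∀ i, y i ∈ kernels S A) ∧
    ((M.p = ∞ ∧ ∀ i, M.metric.d (y i) (M.nominal s i) ≤ M.radius) ∨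
     (M.p ≠ ∞ ∧ (N : ℝ)⁻¹ * ∑ i, M.metric.d (y i) (M.nominal s i) ^ M.p.toReal
        ≤ M.radius ^ M.p.toReal))}

/-- Bregman divergence of the minimizing player. -/
def divX (x x' : Fin A → ℝ) : ℝ := (1 / 2) * ∑ a, (x a - x' a) ^ 2

/-- Bregman divergence of the maximizing player. -/
def divY (y y' : Fin N → Kern S A) : ℝ :=
  ∑ i, (1 / 2) * ∑ a, ∑ s', (y i a s' - y' i a s') ^ 2

/-- `x ∈ argmin_{z ∈ Δ(A)} ⟨g, z⟩ + D_X(z, x')`. -/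
def IsProxX (g x' x : Fin A → ℝ) : Prop :=
  x ∈ stdSimplex ℝ (Fin A) ∧
    IsMinOn (fun z => ∑ a, g a * z a + divX z x') (stdSimplex ℝ (Fin A)) x

/-- `y ∈ argmax_{z ∈ Y_s} ⟨g, z⟩ - D_Y(z, y')`, with `Y_s` the set of admissible tuples. -/
def IsProxY (s : Fin S) (g y' y : Fin N → Kern S A) : Prop :=
  y ∈ M.tuples s ∧
    IsMaxOn (fun z => ∑ i, ∑ a, ∑ s', g i a s' * z i a s' - divY z y') (M.tuples s) y

/-- `R_X`, the maximal Euclidean norm on `Δ(A)`. -/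
def RX (A : ℕ) : ℝ :=
  sSup ((fun x : Fin A → ℝ => Real.sqrt (∑ a, x a ^ 2)) '' stdSimplex ℝ (Fin A))

/-- `R_Y`, the maximal Euclidean norm of the admissible tuples, over all states. -/
def RY : ℝ :=
  ⨆ s, sSup ((fun y : Fin N → Kern S A => Real.sqrt (∑ i, ∑ a, ∑ s', y i a s' ^ 2)) ''
    M.tuples s)

/-- `Θ_X`, the maximum of `D_X` on `Δ(A) × Δ(A)`. -/
def widthX (A : ℕ) : ℝ :=
  sSup ((fun z : (Fin A → ℝ) × (Fin A → ℝ) => divX z.1 z.2) ''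
    (stdSimplex ℝ (Fin A) ×ˢ stdSimplex ℝ (Fin A)))

/-- `Θ_Y`, the maximum of `D_Y` on `Y_s × Y_s`, over all states `s`. -/
def widthY : ℝ :=
  ⨆ s, sSup ((fun z : (Fin N → Kern S A) × (Fin N → Kern S A) => divY z.1 z.2) ''
    (M.tuples s ×ˢ M.tuples s))

/-! ### The algorithm -/

/-- Step size `τ = (√A λ ‖v‖₂)⁻¹` of the minimizing player. -/
def stepX (v : Fin S → ℝ) : ℝ := (Real.sqrt A * M.disc * l2norm v)⁻¹

/-- Step size `σ = N √A (λ ‖v‖₂)⁻¹` of the maximizing player. -/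
def stepY (v : Fin S → ℝ) : ℝ := N * Real.sqrt A * (M.disc * l2norm v)⁻¹

/-- Gradient in `x`: `c'_a = c_{sa} + λ (1/N) ∑ᵢ y_{i,a}ᵀ v`. -/
def gradX (v : Fin S → ℝ) (s : Fin S) (y : Fin N → Kern S A) (a : Fin A) : ℝ :=
  M.cost s a + M.disc * ((N : ℝ)⁻¹ * ∑ i, ∑ s', y i a s' * v s')

/-- Gradient in `(yᵢ)ᵢ`, to be ascended, at the extrapolated point `2 xnew - x`. -/
def gradY (v : Fin S → ℝ) (xnew x : Fin A → ℝ) : Fin N → Kern S A :=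
  fun _ a s' => M.disc / N * (2 * xnew a - x a) * v s'

/-- `(v, x, y)` is produced by the algorithm: `v ℓ` (`ℓ ≥ 1`) is the value vector of epoch `ℓ`,
`x t` and `y t` are the policy and the tuples of kernels after `t` iterations, and the starting
point `v 1`, `x 0`, `y 0` is arbitrary. -/
structure IsRun (v : ℕ → Fin S → ℝ) (x : ℕ → Fin S → Fin A → ℝ)
    (y : ℕ → Fin S → Fin N → Kern S A) : Prop where
  x_init : ∀ s, x 0 s ∈ stdSimplex ℝ (Fin A)
  y_init : ∀ s, y 0 s ∈ M.tuples s
  x_step : ∀ ℓ, 1 ≤ ℓ → ∀ t ∈ Finset.Ico (epochStart ℓ) (epochStart ℓ + ℓ ^ 2), ∀ s,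
    IsProxX (M.stepX (v ℓ) • M.gradX (v ℓ) s (y t s)) (x t s) (x (t + 1) s)
  y_step : ∀ ℓ, 1 ≤ ℓ → ∀ t ∈ Finset.Ico (epochStart ℓ) (epochStart ℓ + ℓ ^ 2), ∀ s,
    M.IsProxY s (M.stepY (v ℓ) • M.gradY (v ℓ) (x (t + 1) s) (x t s)) (y t s) (y (t + 1) s)
  v_step : ∀ ℓ, 1 ≤ ℓ → ∀ s, v (ℓ + 1) s =
    M.eval (linAvg (epochStart ℓ) (epochStart ℓ + ℓ ^ 2) (fun t => x t s))
      (meanKernel (linAvg (epochStart ℓ) (epochStart ℓ + ℓ ^ 2) (fun t => y t s))) (v ℓ) s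

/-- The policy returned after `T` iterations. -/
def outX (x : ℕ → Fin S → Fin A → ℝ) (T : ℕ) (s : Fin S) : Fin A → ℝ :=
  linAvg 0 T (fun t => x t s)

/-- The average kernel of the tuples returned after `T` iterations. -/
def outY (y : ℕ → Fin S → Fin N → Kern S A) (T : ℕ) (s : Fin S) : Kern S A :=
  meanKernel (linAvg 0 T (fun t => y t s))

/-- `Θ_X / τ + Θ_Y / σ` for the step sizes of an epoch with value vector `v`. -/
def stepTerm (v : Fin S → ℝ) : ℝ := widthX A / M.stepX v + M.widthY / M.stepY v

/-- The rate `C (√S / √N) R_X R_Y ω T^{-2/3}`. -/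
def rate (C ω : ℝ) (T : ℕ) : ℝ :=
  C * (Real.sqrt S / Real.sqrt N) * RX A * M.RY * ω * (T : ℝ) ^ (-(2 / 3) : ℝ)

end Model

end WDRMDP

end

/-!
In every state the algorithm runs the primal-dual (Chambolle-Pock) method on the bilinear saddle
function `L_v(x, y) = F^{x, mean y}(v)_s` over `Δ(A) × Y_s`, so the proof combines the analysis of
that method with the contraction of value iteration.

*From measures to tuples.* The set `𝔹_s` of expected kernels is the set of averages of admissible
tuples (`expectedKernels_eq`). One inclusion is the obvious coupling; for the other one, a coupling
is averaged over the fibers above the nominal kernels, Jensen's inequality controls the cost, and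
compactness handles the infimum over couplings. Hence `vstar s` is the value of the game `L_vstar`.

*One epoch.* The step sizes satisfy `τ σ ‖K‖² ≤ 1` for the coupling `K`, so the energy
`D_X/τ + D_Y/σ - K` relative to a comparator is nonnegative and at most `2 (Θ_X/τ + Θ_Y/σ)`, and
each iteration bounds the gap by the decrease of the energy (`saddle_sub_le_energy_sub`). Summation
by parts with the weights `t` bounds the weighted gaps of an epoch, stopped after iteration `b`, by
`2 Ω b`, where `Ω` bounds `Θ_X/τ + Θ_Y/σ` (`IsRun.sum_epoch_le`). The weights of the whole epoch
`ℓ` add up to at least `ℓ² b / 2`, whence its averages are `4 Ω / ℓ²`-approximate saddle points.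

*Value vectors.* Therefore `‖v^{ℓ+1} - vstar‖ ≤ λ ‖v^ℓ - vstar‖ + 4 Ω / ℓ²`, which forces
`‖v^ℓ - vstar‖ = O((Ω + ‖v^1 - vstar‖) / ℓ²)`. The initial error is itself `O(Ω)`: in the supremum
norm, `v^ℓ → vstar`, and `Θ_X/τ + Θ_Y/σ` dominates `‖v^ℓ‖` because `Θ_X ≥ 1` for `A ≥ 2`, while for
`A = 1` the width `Θ_Y / N` is bounded below in terms of the radius (`le_widthY`), except when both
players have only one choice and the gap vanishes.

*Output.* Replacing `v^ℓ` by `vstar` in epoch `ℓ` costs `O(Ω / ℓ²)` per iteration, so the weighted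
gaps of the first `T` iterations sum to `O(Ω ℓ T)`, with `ℓ = O(T^{1/3})` the current epoch;
division by `∑ t = T (T + 1) / 2` gives `O(Ω T^{-2/3})` (`IsRun.saddle_output_le`). The factor
`(√S / √N) R_X R_Y` is at least `1`. The second bound follows from the first one with twice the
constant, as the suprema over the started epochs increase to the full supremum.
-/

noncomputable section

open MeasureTheory
open scoped ENNReal

namespace WDRMDP

variable {S A N : ℕ}

/-! ### The base metrics -/

namespace BaseMetric

variable (m : BaseMetric)

lemma d_eq_sub (y z : Kern S A) : m.d y z = m.d (y - z) 0 := by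
  cases m <;> simp [d]

lemma d_add_le (u w : Kern S A) : m.d (u + w) 0 ≤ m.d u 0 + m.d w 0 := by
  cases m
  · simp only [d, Pi.zero_apply, sub_zero, Pi.add_apply, ← Finset.sum_add_distrib]
    gcongr
    exact abs_add_le _ _
  · have key : ∀ u : Kern S A, d .l2 u 0 =
        ‖WithLp.toLp 2 (fun q : Fin A × Fin S => u q.1 q.2)‖ := fun u => by
      simp [d, EuclideanSpace.norm_eq, Fintype.sum_prod_type]
    rw [key u, key w, key (u + w)]
    have e : WithLp.toLp 2 (fun q : Fin A × Fin S => (u + w) q.1 q.2) =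
        WithLp.toLp 2 (fun q : Fin A × Fin S => u q.1 q.2) +
          WithLp.toLp 2 (fun q : Fin A × Fin S => w q.1 q.2) := by
      rw [← WithLp.toLp_add]; rfl
    rw [e]
    exact norm_add_le _ _
  · simpa only [d, sub_zero] using norm_add_le u w

lemma d_smul (c : ℝ) (u : Kern S A) : m.d (c • u) 0 = |c| * m.d u 0 := by
  cases m
  · simp [d, abs_mul, Finset.mul_sum]
  · have : ∑ a, ∑ s', ((c • u) a s' - (0 : Kern S A) a s') ^ 2 =
        c ^ 2 * ∑ a, ∑ s', (u a s' - (0 : Kern S A) a s') ^ 2 := by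
      simp [mul_pow, Finset.mul_sum]
    rw [d, this, Real.sqrt_mul (sq_nonneg c), Real.sqrt_sq_eq_abs, d]
  · simp [d, norm_smul]

lemma d_nonneg (y z : Kern S A) : 0 ≤ m.d y z := by
  cases m <;> simp only [d] <;> positivity

lemma d_self (y : Kern S A) : m.d y y = 0 := by
  cases m <;> simp [d]

lemma eq_of_d_le_zero {y z : Kern S A} (h : m.d y z ≤ 0) : y = z := by
  have h0 : m.d y z = 0 := le_antisymm h (m.d_nonneg y z)
  cases m
  · simp only [d] at h0
    rw [Finset.sum_eq_zero_iff_of_nonneg (fun _ _ => by positivity)] at h0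
    ext a s'
    have := h0 a (Finset.mem_univ _)
    rw [Finset.sum_eq_zero_iff_of_nonneg (fun _ _ => by positivity)] at this
    simpa [sub_eq_zero] using this s' (Finset.mem_univ _)
  · simp only [d] at h0
    rw [Real.sqrt_eq_zero (by positivity),
      Finset.sum_eq_zero_iff_of_nonneg (fun _ _ => by positivity)] at h0
    ext a s'
    have := h0 a (Finset.mem_univ _)
    rw [Finset.sum_eq_zero_iff_of_nonneg (fun _ _ => by positivity)] at this
    simpa [sub_eq_zero] using this s' (Finset.mem_univ _)
  · simpa [d, sub_eq_zero] using h0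

lemma continuous_d : Continuous fun z : Kern S A × Kern S A => m.d z.1 z.2 := by
  cases m <;> simp only [d] <;> fun_prop

lemma convexOn_d (w : Kern S A) : ConvexOn ℝ Set.univ fun y => m.d y w := by
  refine ⟨convex_univ, fun y _ z _ a b ha hb hab => ?_⟩
  have e : a • y + b • z - w = a • (y - w) + b • (z - w) := by
    conv_lhs => rw [← one_smul ℝ w, ← hab]
    module
  simp only [smul_eq_mul]
  rw [d_eq_sub, e, m.d_eq_sub y, m.d_eq_sub z]
  refine (m.d_add_le _ _).trans ?_
  rw [d_smul, d_smul, abs_of_nonneg ha, abs_of_nonneg hb]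

lemma convexOn_d_rpow (w : Kern S A) {q : ℝ} (hq : 1 ≤ q) :
    ConvexOn ℝ Set.univ fun y => m.d y w ^ q := by
  refine ⟨convex_univ, fun y hy z hz a b ha hb hab => ?_⟩
  refine (Real.rpow_le_rpow (m.d_nonneg _ _) ((m.convexOn_d w).2 hy hz ha hb hab)
    (by linarith)).trans ?_
  exact (convexOn_rpow hq).2 (m.d_nonneg y w) (m.d_nonneg z w) ha hb hab

/-- For a single action, two distributions are at distance at most `2` in each of the metrics. -/
lemma d_le_two {y z : Kern S A} (hA : A = 1) (hy : y ∈ kernels S A) (hz : z ∈ kernels S A) :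
    m.d y z ≤ 2 := by
  subst hA
  have hl1 : ∑ s', |y 0 s' - z 0 s'| ≤ 2 := by
    calc ∑ s', |y 0 s' - z 0 s'| ≤ ∑ s', (y 0 s' + z 0 s') := by
          gcongr with s'
          have := (hy 0).1 s'
          have := (hz 0).1 s'
          rw [abs_le]; constructor <;> linarith
      _ = 2 := by
          rw [Finset.sum_add_distrib, (hy 0).2, (hz 0).2]; norm_num
  cases m
  · simpa [d] using hl1
  · simp only [d, Finset.univ_unique, Fin.default_eq_zero, Fin.isValue, Finset.sum_singleton]
    rw [Real.sqrt_le_left (by norm_num)]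
    calc ∑ s', (y 0 s' - z 0 s') ^ 2 = ∑ s', |y 0 s' - z 0 s'| ^ 2 := by simp
      _ ≤ (∑ s', |y 0 s' - z 0 s'|) ^ 2 :=
          Finset.sum_sq_le_sq_sum_of_nonneg (fun _ _ => abs_nonneg _)
      _ ≤ 2 ^ 2 := by gcongr
  · simp only [d]
    rw [pi_norm_le_iff_of_nonneg (by norm_num)]
    intro a
    rw [pi_norm_le_iff_of_nonneg (by norm_num)]
    intro s'
    have : a = 0 := Subsingleton.elim _ _
    subst this
    refine le_trans ?_ hl1
    exact Finset.single_le_sum (f := fun s' => |y 0 s' - z 0 s'|)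
      (fun _ _ => abs_nonneg _) (Finset.mem_univ s')

end BaseMetric

/-! ### Kernels and tuples of kernels -/

lemma convex_kernels : Convex ℝ (kernels S A) := by
  have : kernels S A = Set.univ.pi fun _ => stdSimplex ℝ (Fin S) := by
    ext y; simp [kernels]
  rw [this]
  exact convex_pi fun _ _ => convex_stdSimplex ℝ _

lemma isCompact_kernels : IsCompact (kernels S A) := by
  have : kernels S A = Set.univ.pi fun _ => stdSimplex ℝ (Fin S) := by
    ext y; simp [kernels]
  rw [this]
  exact isCompact_univ_pi fun _ => isCompact_stdSimplex ℝ _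

lemma isClosed_kernels : IsClosed (kernels S A) := isCompact_kernels.isClosed

lemma norm_le_one_of_mem_kernels {y : Kern S A} (hy : y ∈ kernels S A) : ‖y‖ ≤ 1 := by
  rw [pi_norm_le_iff_of_nonneg zero_le_one]
  intro a
  rw [pi_norm_le_iff_of_nonneg zero_le_one]
  intro s'
  rw [Real.norm_eq_abs, abs_of_nonneg ((hy a).1 s'), ← (hy a).2]
  exact Finset.single_le_sum (fun s' _ => (hy a).1 s') (Finset.mem_univ s')

lemma convex_kernel_tuples : Convex ℝ {y : Fin N → Kern S A | ∀ i, y i ∈ kernels S A} := by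
  have : {y : Fin N → Kern S A | ∀ i, y i ∈ kernels S A} =
      Set.univ.pi fun _ => kernels S A := by ext y; simp
  rw [this]
  exact convex_pi fun _ _ => convex_kernels

lemma isCompact_kernel_tuples : IsCompact {y : Fin N → Kern S A | ∀ i, y i ∈ kernels S A} := by
  have : {y : Fin N → Kern S A | ∀ i, y i ∈ kernels S A} =
      Set.univ.pi fun _ => kernels S A := by ext y; simp
  rw [this]
  exact isCompact_univ_pi fun _ => isCompact_kernels

lemma meanKernel_mem_kernels (hN : 1 ≤ N) {y : Fin N → Kern S A}
    (hy : ∀ i, y i ∈ kernels S A) : meanKernel y ∈ kernels S A := by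
  have hN' : (N : ℝ) ≠ 0 := by positivity
  rw [meanKernel, Finset.smul_sum]
  exact convex_kernels.sum_mem (fun _ _ => by positivity) (by simp [hN']) fun i _ => hy i

lemma continuous_meanKernel : Continuous (meanKernel : (Fin N → Kern S A) → Kern S A) := by
  unfold meanKernel
  fun_prop

namespace Model

variable (M : Model S A N)

open Classical in
/-- The `ℓ_p`-type distance of a tuple of kernels from the nominal tuple; the admissible tuples are
the tuples of kernels whose spread is at most the radius. For `p = ∞` it is the supremum norm of
the vector of distances. -/
def spread (s : Fin S) (y : Fin N → Kern S A) : ℝ :=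
  if M.p = ∞ then ‖fun i => M.metric.d (y i) (M.nominal s i)‖
  else ((N : ℝ)⁻¹ * ∑ i, M.metric.d (y i) (M.nominal s i) ^ M.p.toReal) ^ M.p.toReal⁻¹

lemma one_le_toReal (hp : M.p ≠ ∞) : 1 ≤ M.p.toReal := by
  simpa using (ENNReal.toReal_le_toReal ENNReal.one_ne_top hp).2 M.one_le_p

lemma mem_tuples_iff (s : Fin S) (y : Fin N → Kern S A) :
    y ∈ M.tuples s ↔ (∀ i, y i ∈ kernels S A) ∧ M.spread s y ≤ M.radius := by
  simp only [tuples, Set.mem_ofPred_eq]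
  refine and_congr_right fun _ => ?_
  by_cases hp : M.p = ∞
  · simp only [spread, hp, true_and, ne_eq, not_true_eq_false, false_and, or_false, if_true]
    rw [pi_norm_le_iff_of_nonneg M.radius_nonneg]
    simp [abs_of_nonneg (M.metric.d_nonneg _ _)]
  · have h1 := M.one_le_toReal hp
    simp only [spread, hp, false_and, ne_eq, not_false_eq_true, true_and, false_or, if_false]
    have h0 : 0 ≤ (N : ℝ)⁻¹ * ∑ i, M.metric.d (y i) (M.nominal s i) ^ M.p.toReal :=
      mul_nonneg (by positivity)
        (Finset.sum_nonneg fun i _ => Real.rpow_nonneg (M.metric.d_nonneg _ _) _)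
    rw [Real.rpow_inv_le_iff_of_pos h0 M.radius_nonneg (by linarith)]

lemma continuous_spread (s : Fin S) : Continuous (M.spread s) := by
  have hd : ∀ i, Continuous fun y : Fin N → Kern S A => M.metric.d (y i) (M.nominal s i) :=
    fun i => M.metric.continuous_d.comp (f := fun y : Fin N → Kern S A => (y i, M.nominal s i))
      (by fun_prop)
  unfold spread
  split_ifs with hp
  · exact (continuous_pi hd).norm
  · have h1 := M.one_le_toReal hp
    refine Continuous.rpow_const ?_ fun _ => Or.inr (by positivity)
    refine continuous_const.mul (continuous_finsetSum _ fun i _ => ?_)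
    exact (hd i).rpow_const fun _ => Or.inr (by positivity)

lemma isCompact_tuples (s : Fin S) : IsCompact (M.tuples s) := by
  have : M.tuples s = {y | ∀ i, y i ∈ kernels S A} ∩ {y | M.spread s y ≤ M.radius} := by
    ext y; exact M.mem_tuples_iff s y
  rw [this]
  exact isCompact_kernel_tuples.inter_right
    (isClosed_le (M.continuous_spread s) continuous_const)

lemma convex_tuples (s : Fin S) : Convex ℝ (M.tuples s) := by
  intro y hy z hz a b ha hb hab
  refine ⟨convex_kernel_tuples hy.1 hz.1 ha hb hab, ?_⟩
  rcases hy.2 with ⟨hp, hy2⟩ | ⟨hp, hy2⟩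
  · rcases hz.2 with ⟨_, hz2⟩ | ⟨hp', _⟩
    · refine Or.inl ⟨hp, fun i => ((M.metric.convexOn_d (M.nominal s i)).2 (Set.mem_univ (y i))
        (Set.mem_univ (z i)) ha hb hab).trans ?_⟩
      simp only [smul_eq_mul]
      calc _ ≤ a * M.radius + b * M.radius := by gcongr <;> [exact hy2 i; exact hz2 i]
        _ = M.radius := by rw [← add_mul, hab, one_mul]
    · exact absurd hp hp'
  · rcases hz.2 with ⟨hp', _⟩ | ⟨_, hz2⟩
    · exact absurd hp' hp
    · refine Or.inr ⟨hp, ?_⟩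
      have h1 := M.one_le_toReal hp
      calc _ ≤ (N : ℝ)⁻¹ * ∑ i, (a * M.metric.d (y i) (M.nominal s i) ^ M.p.toReal +
              b * M.metric.d (z i) (M.nominal s i) ^ M.p.toReal) := by
            gcongr with i
            exact (M.metric.convexOn_d_rpow (M.nominal s i) h1).2 (Set.mem_univ (y i))
              (Set.mem_univ (z i)) ha hb hab
        _ = a * ((N : ℝ)⁻¹ * ∑ i, M.metric.d (y i) (M.nominal s i) ^ M.p.toReal) +
              b * ((N : ℝ)⁻¹ * ∑ i, M.metric.d (z i) (M.nominal s i) ^ M.p.toReal) := by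
            rw [Finset.sum_add_distrib, ← Finset.mul_sum, ← Finset.mul_sum]; ring
        _ ≤ a * M.radius ^ M.p.toReal + b * M.radius ^ M.p.toReal := by gcongr
        _ = M.radius ^ M.p.toReal := by rw [← add_mul, hab, one_mul]

/-- A tuple of kernels each of which is within the radius of its nominal kernel is admissible,
whatever the type of the Wasserstein distance. -/
lemma mem_tuples_of_d_le (hN : 1 ≤ N) (s : Fin S) {y : Fin N → Kern S A}
    (hy : ∀ i, y i ∈ kernels S A) (hd : ∀ i, M.metric.d (y i) (M.nominal s i) ≤ M.radius) :
    y ∈ M.tuples s := by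
  refine ⟨hy, ?_⟩
  by_cases hp : M.p = ∞
  · exact Or.inl ⟨hp, hd⟩
  · have h1 := M.one_le_toReal hp
    have hN' : (N : ℝ) ≠ 0 := by positivity
    refine Or.inr ⟨hp, ?_⟩
    calc _ ≤ (N : ℝ)⁻¹ * ∑ _i : Fin N, M.radius ^ M.p.toReal := by
          gcongr with i
          · exact M.metric.d_nonneg _ _
          · exact hd i
      _ = M.radius ^ M.p.toReal := by simp [hN']

lemma nominal_mem_tuples (hN : 1 ≤ N) (s : Fin S) : M.nominal s ∈ M.tuples s :=
  M.mem_tuples_of_d_le hN s (M.nominal_mem s) fun i => by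
    rw [BaseMetric.d_self]; exact M.radius_nonneg

/-- For radius zero the nominal tuple is the only admissible one. -/
lemma eq_nominal_of_radius_eq_zero (hN : 1 ≤ N) (h0 : M.radius = 0) {s : Fin S}
    {y : Fin N → Kern S A} (hy : y ∈ M.tuples s) : y = M.nominal s := by
  funext i
  apply M.metric.eq_of_d_le_zero
  rcases hy.2 with ⟨_, h⟩ | ⟨hp, h⟩
  · exact h0 ▸ h i
  · have h1 := M.one_le_toReal hp
    have hN' : 0 < (N : ℝ) := by positivity
    rw [h0, Real.zero_rpow (by linarith)] at h
    have hs : ∑ i, M.metric.d (y i) (M.nominal s i) ^ M.p.toReal ≤ 0 := by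
      by_contra hc
      push Not at hc
      have := mul_pos (inv_pos.2 hN') hc
      linarith
    have hi : M.metric.d (y i) (M.nominal s i) ^ M.p.toReal ≤ 0 :=
      (Finset.single_le_sum (f := fun i => M.metric.d (y i) (M.nominal s i) ^ M.p.toReal)
        (fun i _ => Real.rpow_nonneg (M.metric.d_nonneg _ _) _) (Finset.mem_univ i)).trans hs
    by_contra hc
    push Not at hc
    exact absurd (Real.rpow_pos_of_pos hc M.p.toReal) (not_lt.2 hi)

/-! ### The expected kernels are the averages of the admissible tuples -/

open Classical in
/-- If the second marginal of `κ` is the nominal measure, then integrating against `κ` amounts to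
averaging, over `i`, the means over the fibers above the `i`-th nominal kernel. Nominal kernels may
coincide, which is why the fibers are grouped by value. -/
lemma average_fibers_eq_integral {E : Type*} [NormedAddCommGroup E] [NormedSpace ℝ E]
    {s : Fin S} {κ : Measure (Kern S A × Kern S A)} [IsProbabilityMeasure κ]
    (hκ : κ.map Prod.snd = M.nominalMeasure s) {f : Kern S A × Kern S A → E}
    (hf : Integrable f κ) :
    (N : ℝ)⁻¹ • ∑ i, ⨍ z in Prod.snd ⁻¹' {M.nominal s i}, f z ∂κ = ∫ z, f z ∂κ := by
  set W : Finset (Kern S A) := Finset.univ.image (M.nominal s) with hW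
  have hms : ∀ w : Kern S A,
      MeasurableSet (Prod.snd ⁻¹' {w} : Set (Kern S A × Kern S A)) :=
    fun w => measurable_snd (measurableSet_singleton w)
  have hmass : ∀ w : Kern S A, κ.real (Prod.snd ⁻¹' {w}) =
      (N : ℝ)⁻¹ * (Finset.univ.filter fun i => M.nominal s i = w).card := by
    intro w
    rw [measureReal_def, ← Measure.map_apply measurable_snd (measurableSet_singleton w), hκ,
      nominalMeasure]
    simp [Measure.dirac_apply' _ (measurableSet_singleton w), Set.indicator_apply]
  have hae : ∀ᵐ z ∂κ, z ∈ ⋃ w ∈ W, (Prod.snd ⁻¹' {w} : Set (Kern S A × Kern S A)) := by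
    have h1 : ∀ᵐ w ∂(κ.map Prod.snd), w ∈ (W : Set (Kern S A)) := by
      rw [hκ, nominalMeasure]
      refine Measure.ae_smul_measure ?_ _
      rw [ae_iff]
      simp only [Measure.coe_finsetSum, Finset.sum_apply]
      refine Finset.sum_eq_zero fun i _ => ?_
      rw [← ae_iff]
      exact (ae_dirac_iff W.finite_toSet.measurableSet).2 (by simp [hW])
    filter_upwards [ae_of_ae_map measurable_snd.aemeasurable h1] with z hz
    simpa using hz
  have hsum : ∫ z, f z ∂κ = ∑ w ∈ W, ∫ z in Prod.snd ⁻¹' {w}, f z ∂κ := by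
    rw [← integral_biUnion_finset W (fun w _ => hms w) _ fun w _ => hf.integrableOn,
      Measure.restrict_eq_self_of_ae_mem hae]
    intro w _ w' _ hww
    exact Disjoint.preimage _ (by simpa using hww)
  rw [hsum, Finset.sum_comp (fun w => ⨍ z in Prod.snd ⁻¹' {w}, f z ∂κ) (M.nominal s),
    Finset.smul_sum]
  refine Finset.sum_congr rfl fun w _ => ?_
  rw [← measure_smul_setAverage _ (measure_ne_top κ _), hmass, mul_smul, Nat.cast_smul_eq_nsmul]

/-- Averaging a coupling over the fibers above the nominal kernels turns it into a tuple whose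
spread is, by Jensen's inequality, at most the cost of the coupling. -/
lemma exists_tuple_of_coupling {s : Fin S} {κ : Measure (Kern S A × Kern S A)}
    [IsProbabilityMeasure κ] (h1 : ∀ᵐ z ∂κ, z.1 ∈ kernels S A)
    (h2 : κ.map Prod.snd = M.nominalMeasure s) {r : ℝ} (hr : 0 ≤ r)
    (hcost : eLpNorm (fun z : Kern S A × Kern S A => M.metric.d z.1 z.2) M.p κ
      ≤ ENNReal.ofReal r) :
    ∃ y : Fin N → Kern S A, (∀ i, y i ∈ kernels S A) ∧ meanKernel y = ∫ z, z.1 ∂κ ∧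
      M.spread s y ≤ r := by
  set F : Fin N → Set (Kern S A × Kern S A) := fun i => Prod.snd ⁻¹' {M.nominal s i} with hF
  have hFm : ∀ i, MeasurableSet (F i) := fun i => measurable_snd (measurableSet_singleton _)
  have hF0 : ∀ i, κ (F i) ≠ 0 := by
    intro i
    rw [hF, ← Measure.map_apply measurable_snd (measurableSet_singleton _), h2, nominalMeasure]
    simp only [Measure.smul_apply, Measure.coe_finsetSum, Finset.sum_apply, smul_eq_mul]
    refine mul_ne_zero (by simp) fun h0 => ?_
    have := Finset.sum_eq_zero_iff.1 h0 i (Finset.mem_univ i)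
    simp at this
  have hfst : Integrable (fun z : Kern S A × Kern S A => z.1) κ :=
    Integrable.of_bound measurable_fst.aestronglyMeasurable 1
      (h1.mono fun z hz => norm_le_one_of_mem_kernels hz)
  have hdm : AEStronglyMeasurable (fun z : Kern S A × Kern S A => M.metric.d z.1 z.2) κ :=
    M.metric.continuous_d.measurable.aestronglyMeasurable
  refine ⟨fun i => ⨍ z in F i, z.1 ∂κ, fun i => ?_, ?_, ?_⟩
  · exact convex_kernels.set_average_mem isClosed_kernels (hF0 i) (measure_ne_top _ _)
      (ae_restrict_of_ae h1) hfst.integrableOn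
  · exact M.average_fibers_eq_integral h2 hfst
  · have hd_congr : ∀ (i : Fin N), ∀ z ∈ F i,
        M.metric.d z.1 (M.nominal s i) = M.metric.d z.1 z.2 := by
      intro i z hz
      rw [show z.2 = M.nominal s i from hz]
    by_cases hp : M.p = ∞
    · rw [hp, eLpNorm_exponent_top] at hcost
      rw [spread, if_pos hp, pi_norm_le_iff_of_nonneg hr]
      intro i
      rw [Real.norm_eq_abs, abs_of_nonneg (M.metric.d_nonneg _ _)]
      have hconv : Convex ℝ {u : Kern S A | M.metric.d u (M.nominal s i) ≤ r} := by
        simpa using (M.metric.convexOn_d (M.nominal s i)).convex_le r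
      have hclosed : IsClosed {u : Kern S A | M.metric.d u (M.nominal s i) ≤ r} :=
        isClosed_le (M.metric.continuous_d.comp (f := fun u : Kern S A => (u, M.nominal s i))
          (by fun_prop)) continuous_const
      refine hconv.set_average_mem hclosed (hF0 i) (measure_ne_top _ _) ?_ hfst.integrableOn
      refine (ae_restrict_iff' (hFm i)).2 ?_
      filter_upwards [ae_le_eLpNormEssSup (μ := κ)
        (f := fun z : Kern S A × Kern S A => M.metric.d z.1 z.2)] with z hz hzi
      have h3 := hz.trans hcost
      rw [Real.enorm_eq_ofReal (M.metric.d_nonneg _ _), ENNReal.ofReal_le_ofReal_iff hr] at h3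
      exact (hd_congr i z hzi).trans_le h3
    · have hp1 := M.one_le_toReal hp
      have hp0 : M.p ≠ 0 := by
        intro h0; rw [h0] at hp1; norm_num at hp1
      have hmem : MemLp (fun z : Kern S A × Kern S A => M.metric.d z.1 z.2) M.p κ :=
        ⟨hdm, hcost.trans_lt ENNReal.ofReal_lt_top⟩
      have hint : Integrable (fun z : Kern S A × Kern S A =>
          M.metric.d z.1 z.2 ^ M.p.toReal) κ := by
        have := hmem.integrable_norm_rpow hp0 hp
        simpa only [Real.norm_eq_abs, abs_of_nonneg (M.metric.d_nonneg _ _)] using this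
      rw [hmem.eLpNorm_eq_integral_rpow_norm hp0 hp, ENNReal.ofReal_le_ofReal_iff hr] at hcost
      simp only [Real.norm_eq_abs, abs_of_nonneg (M.metric.d_nonneg _ _)] at hcost
      rw [spread, if_neg hp]
      refine le_trans ?_ hcost
      refine Real.rpow_le_rpow ?_ ?_ (by positivity)
      · exact mul_nonneg (by positivity)
          (Finset.sum_nonneg fun i _ => Real.rpow_nonneg (M.metric.d_nonneg _ _) _)
      rw [← M.average_fibers_eq_integral h2 hint, smul_eq_mul]
      gcongr with i
      calc M.metric.d (⨍ z in F i, z.1 ∂κ) (M.nominal s i) ^ M.p.toReal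
          ≤ ⨍ z in F i, M.metric.d z.1 (M.nominal s i) ^ M.p.toReal ∂κ := by
            refine (M.metric.convexOn_d_rpow (M.nominal s i) hp1).map_set_average_le ?_
              isClosed_univ (hF0 i) (measure_ne_top _ _) (by simp) hfst.integrableOn ?_
            · refine Continuous.continuousOn (Continuous.rpow_const ?_ fun _ =>
                Or.inr (by positivity))
              exact M.metric.continuous_d.comp
                (f := fun u : Kern S A => (u, M.nominal s i)) (by fun_prop)
            · refine hint.integrableOn.congr_fun (fun z hz => ?_) (hFm i)
              simp only [Function.comp]
              rw [hd_congr i z hz]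
        _ = ⨍ z in F i, M.metric.d z.1 z.2 ^ M.p.toReal ∂κ := by
            refine setAverage_congr_fun (hFm i) (ae_of_all _ fun z hz => ?_)
            rw [hd_congr i z hz]

lemma integrable_id_of_mem_ambiguity {s : Fin S} {μ : Measure (Kern S A)}
    (hμ : μ ∈ M.ambiguity s) : Integrable (fun z => z) μ := by
  have := hμ.1
  refine Integrable.of_bound aestronglyMeasurable_id 1 ?_
  have h : ∀ᵐ z ∂μ, z ∈ kernels S A := hμ.2.1
  exact h.mono fun z hz => norm_le_one_of_mem_kernels hz

/-- The expectation of a measure in the Wasserstein ball is the average of an admissible tuple. The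
infimum defining the Wasserstein distance need not be attained, so couplings of cost `r` are used
for every `r` above the radius, and the spread is minimized over the compact set of tuples with
the given average. -/
lemma exists_tuple_of_mem_ambiguity {s : Fin S} {μ : Measure (Kern S A)}
    (hμ : μ ∈ M.ambiguity s) : ∃ y ∈ M.tuples s, meanKernel y = ∫ z, z ∂μ := by
  have := hμ.1
  have hsupp : ∀ᵐ z ∂μ, z ∈ kernels S A := hμ.2.1
  have happrox : ∀ r, M.radius < r → ∃ y : Fin N → Kern S A, (∀ i, y i ∈ kernels S A) ∧
      meanKernel y = ∫ z, z ∂μ ∧ M.spread s y ≤ r := by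
    intro r hr
    have hr0 : 0 < r := M.radius_nonneg.trans_lt hr
    have hlt : wasserstein M.metric M.p μ (M.nominalMeasure s) < ENNReal.ofReal r :=
      hμ.2.2.trans_lt ((ENNReal.ofReal_lt_ofReal_iff hr0).2 hr)
    obtain ⟨⟨κ, hκ1, hκ2⟩, hκ⟩ := iInf_lt_iff.1 hlt
    have : IsProbabilityMeasure κ := by
      constructor
      rw [← Set.preimage_univ (f := Prod.fst), ← Measure.map_apply measurable_fst MeasurableSet.univ,
        hκ1]
      exact measure_univ
    have hfst : ∀ᵐ z ∂κ, z.1 ∈ kernels S A :=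
      ae_of_ae_map measurable_fst.aemeasurable (hκ1.symm ▸ hsupp)
    obtain ⟨y, hy, hmean, hs⟩ := M.exists_tuple_of_coupling hfst hκ2 hr0.le hκ.le
    refine ⟨y, hy, ?_, hs⟩
    rw [hmean, ← hκ1]
    exact (integral_map measurable_fst.aemeasurable aestronglyMeasurable_id).symm
  have hcomp : IsCompact ({y : Fin N → Kern S A | ∀ i, y i ∈ kernels S A} ∩
      {y | meanKernel y = ∫ z, z ∂μ}) :=
    isCompact_kernel_tuples.inter_right (isClosed_eq continuous_meanKernel continuous_const)
  obtain ⟨y₀, hy₀, hm₀, -⟩ := happrox (M.radius + 1) (by linarith)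
  obtain ⟨y, hy, hmin⟩ := hcomp.exists_isMinOn ⟨y₀, hy₀, hm₀⟩ (M.continuous_spread s).continuousOn
  refine ⟨y, (M.mem_tuples_iff s y).2 ⟨hy.1, le_of_forall_gt_imp_ge_of_dense fun r hr => ?_⟩, hy.2⟩
  obtain ⟨y', hy', hm', hs'⟩ := happrox r hr
  exact (hmin ⟨hy', hm'⟩).trans hs'

/-- The average of an admissible tuple is the mean of its empirical measure, which the obvious
coupling shows to lie in the Wasserstein ball. -/
lemma exists_mem_ambiguity_of_mem_tuples (hN : 1 ≤ N) {s : Fin S} {y : Fin N → Kern S A}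
    (hy : y ∈ M.tuples s) : ∃ μ ∈ M.ambiguity s, ∫ z, z ∂μ = meanKernel y := by
  have hN' : (N : ℝ≥0∞) ≠ 0 := by simp; omega
  set μ : Measure (Kern S A) := (N : ℝ≥0∞)⁻¹ • ∑ i, Measure.dirac (y i) with hμ
  set κ : Measure (Kern S A × Kern S A) :=
    (N : ℝ≥0∞)⁻¹ • ∑ i, Measure.dirac (y i, M.nominal s i) with hκ
  have hprob : IsProbabilityMeasure μ := by
    constructor
    simp [hμ, ENNReal.inv_mul_cancel hN' (ENNReal.natCast_ne_top N)]
  have hmap1 : κ.map Prod.fst = μ := by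
    rw [hκ, Measure.map_smul, Measure.map_finset_sum measurable_fst.aemeasurable]
    simp [Measure.map_dirac' measurable_fst, hμ]
  have hmap2 : κ.map Prod.snd = M.nominalMeasure s := by
    rw [hκ, Measure.map_smul, Measure.map_finset_sum measurable_snd.aemeasurable]
    simp [Measure.map_dirac' measurable_snd, nominalMeasure]
  refine ⟨μ, ⟨hprob, ?_, ?_⟩, ?_⟩
  · simp only [hμ, Measure.smul_apply, Measure.coe_finsetSum, Finset.sum_apply, smul_eq_mul]
    rw [Finset.sum_eq_zero, mul_zero]
    intro i _
    rw [Measure.dirac_apply' _ isClosed_kernels.measurableSet.compl]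
    simp [hy.1 i]
  · refine (iInf_le _ ⟨κ, hmap1, hmap2⟩).trans ?_
    simp only
    rcases hy.2 with ⟨hp, h⟩ | ⟨hp, h⟩
    · rw [hp, eLpNorm_exponent_top]
      refine eLpNormEssSup_le_of_ae_bound ?_
      refine Measure.ae_smul_measure ?_ _
      rw [ae_iff]
      simp only [Measure.coe_finsetSum, Finset.sum_apply]
      refine Finset.sum_eq_zero fun i _ => ?_
      have hcl : MeasurableSet {z : Kern S A × Kern S A |
          ‖M.metric.d z.1 z.2‖ ≤ M.radius} :=
        (isClosed_le M.metric.continuous_d.norm continuous_const).measurableSet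
      rw [← ae_iff, ae_dirac_iff hcl]
      simpa [abs_of_nonneg (M.metric.d_nonneg _ _)] using h i
    · have hp1 := M.one_le_toReal hp
      have hp0 : M.p ≠ 0 := by
        intro h0; rw [h0] at hp1; norm_num at hp1
      have hmeas : Measurable fun z : Kern S A × Kern S A => ‖M.metric.d z.1 z.2‖ₑ ^ M.p.toReal :=
        (M.metric.continuous_d.measurable.enorm).pow_const _
      rw [eLpNorm_eq_lintegral_rpow_enorm_toReal hp0 hp, hκ, lintegral_smul_measure,
        lintegral_finsetSum_measure]
      simp only [lintegral_dirac' _ hmeas, smul_eq_mul]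
      have hsum : (N : ℝ≥0∞)⁻¹ * ∑ i, ‖M.metric.d (y i) (M.nominal s i)‖ₑ ^ M.p.toReal =
          ENNReal.ofReal ((N : ℝ)⁻¹ * ∑ i, M.metric.d (y i) (M.nominal s i) ^ M.p.toReal) := by
        rw [ENNReal.ofReal_mul (by positivity), ENNReal.ofReal_inv_of_pos (by positivity),
          ENNReal.ofReal_natCast, ENNReal.ofReal_sum_of_nonneg
            fun i _ => Real.rpow_nonneg (M.metric.d_nonneg _ _) _]
        congr 1
        refine Finset.sum_congr rfl fun i _ => ?_
        rw [Real.enorm_eq_ofReal (M.metric.d_nonneg _ _),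
          ENNReal.ofReal_rpow_of_nonneg (M.metric.d_nonneg _ _) (by linarith)]
      rw [hsum, one_div, ENNReal.rpow_inv_le_iff (by linarith),
        ENNReal.ofReal_rpow_of_nonneg M.radius_nonneg (by linarith)]
      exact ENNReal.ofReal_le_ofReal h
  · rw [hμ, integral_smul_measure, integral_finsetSum_measure]
    · simp [meanKernel]
    · intro i _
      exact integrable_dirac (by simp)

lemma expectedKernels_eq (hN : 1 ≤ N) (s : Fin S) :
    M.expectedKernels s = meanKernel '' M.tuples s := by
  ext e
  constructor
  · rintro ⟨μ, hμ, rfl⟩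
    exact M.exists_tuple_of_mem_ambiguity hμ
  · rintro ⟨y, hy, rfl⟩
    obtain ⟨μ, hμ, h⟩ := M.exists_mem_ambiguity_of_mem_tuples hN hy
    exact ⟨μ, hμ, h.symm⟩

/-! ### Per-iteration estimate of the primal-dual method -/

/-- The three-point inequality of a proximal step, for an affine objective `f` and a divergence `D`
that is quadratic along segments. -/
lemma three_point {E : Type*} [AddCommGroup E] [Module ℝ E] {C : Set E} (hC : Convex ℝ C)
    {f : E → ℝ} {D : E → E → ℝ} {x' x : E}
    (hf : ∀ u w : E, ∀ η : ℝ, f (u + η • (w - u)) = f u + η * (f w - f u))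
    (hD : ∀ u w : E, ∀ η : ℝ,
      D (u + η • (w - u)) x' = D u x' + η * (D w x' - D w u - D u x') + η ^ 2 * D w u)
    (hx : x ∈ C) (hmin : IsMinOn (fun z => f z + D z x') C x) {z : E} (hz : z ∈ C) :
    f x + D x x' + D z x ≤ f z + D z x' := by
  set G := f z - f x + (D z x' - D z x - D x x') with hG
  have key : ∀ η : ℝ, 0 < η → η ≤ 1 → 0 ≤ G + η * D z x := by
    intro η h0 h1
    have h : f x + D x x' ≤ f (x + η • (z - x)) + D (x + η • (z - x)) x' :=
      hmin (hC.add_smul_sub_mem hx hz ⟨h0.le, h1⟩)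
    rw [hf, hD] at h
    have h' : 0 ≤ η * (G + η * D z x) := by rw [hG]; linarith
    exact nonneg_of_mul_nonneg_right h' h0
  have hG0 : 0 ≤ G := by
    by_contra hneg
    push Not at hneg
    have hpos : 0 < D z x := by
      have := key 1 one_pos le_rfl
      linarith
    -- A step `η` so short that the quadratic term is at most half of `-G`.
    have h1 := key (min 1 (-G / (2 * D z x))) (lt_min one_pos (by positivity [neg_pos.2 hneg]))
      (min_le_left _ _)
    have h2 : min 1 (-G / (2 * D z x)) * D z x ≤ -G / (2 * D z x) * D z x := by
      gcongr
      exact min_le_right _ _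
    have h3 : -G / (2 * D z x) * D z x = -G / 2 := by field_simp
    linarith
  linarith

lemma divX_segment (u w x' : Fin A → ℝ) (η : ℝ) :
    divX (u + η • (w - u)) x' =
      divX u x' + η * (divX w x' - divX w u - divX u x') + η ^ 2 * divX w u := by
  simp only [divX, Finset.mul_sum, ← Finset.sum_add_distrib, ← Finset.sum_sub_distrib,
    Pi.add_apply, Pi.smul_apply, Pi.sub_apply, smul_eq_mul]
  exact Finset.sum_congr rfl fun a _ => by ring

lemma divY_segment (u w y' : Fin N → Kern S A) (η : ℝ) :
    divY (u + η • (w - u)) y' =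
      divY u y' + η * (divY w y' - divY w u - divY u y') + η ^ 2 * divY w u := by
  simp only [divY, Finset.mul_sum, ← Finset.sum_add_distrib, ← Finset.sum_sub_distrib,
    Pi.add_apply, Pi.smul_apply, Pi.sub_apply, smul_eq_mul]
  exact Finset.sum_congr rfl fun i _ => Finset.sum_congr rfl fun a _ =>
    Finset.sum_congr rfl fun s' _ => by ring

lemma divX_nonneg (x x' : Fin A → ℝ) : 0 ≤ divX x x' := by
  unfold divX; positivity

lemma divY_nonneg (y y' : Fin N → Kern S A) : 0 ≤ divY y y' := by
  unfold divY; positivity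

/-- The bilinear part `(λ/N) ∑ᵢ ∑ₐ xₐ y_{i,a}ᵀ v` of the saddle function of a state. -/
def coupling (v : Fin S → ℝ) : (Fin A → ℝ) →ₗ[ℝ] (Fin N → Kern S A) →ₗ[ℝ] ℝ :=
  LinearMap.mk₂ ℝ (fun x y => M.disc / N * ∑ i, ∑ a, ∑ s', x a * y i a s' * v s')
    (fun x x' y => by simp only [Pi.add_apply, add_mul, Finset.sum_add_distrib, mul_add])
    (fun c x y => by
      simp only [Pi.smul_apply, smul_eq_mul, Finset.mul_sum]
      exact Finset.sum_congr rfl fun i _ => Finset.sum_congr rfl fun a _ =>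
        Finset.sum_congr rfl fun s' _ => by ring)
    (fun x y y' => by simp only [Pi.add_apply, add_mul, Finset.sum_add_distrib, mul_add])
    (fun c x y => by
      simp only [Pi.smul_apply, smul_eq_mul, Finset.mul_sum]
      exact Finset.sum_congr rfl fun i _ => Finset.sum_congr rfl fun a _ =>
        Finset.sum_congr rfl fun s' _ => by ring)

lemma coupling_apply (v : Fin S → ℝ) (x : Fin A → ℝ) (y : Fin N → Kern S A) :
    M.coupling v x y = M.disc / N * ∑ i, ∑ a, ∑ s', x a * y i a s' * v s' := rfl

/-- The expected immediate cost of a mixed action, as a linear function of the mixture. -/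
def costLin (s : Fin S) : (Fin A → ℝ) →ₗ[ℝ] ℝ :=
  ∑ a, M.cost s a • LinearMap.proj a

lemma costLin_apply (s : Fin S) (x : Fin A → ℝ) : M.costLin s x = ∑ a, M.cost s a * x a := by
  simp [costLin]

lemma eval_meanKernel (v : Fin S → ℝ) (s : Fin S) (x : Fin A → ℝ) (y : Fin N → Kern S A) :
    M.eval x (meanKernel y) v s = M.costLin s x + M.coupling v x y := by
  rw [costLin_apply, coupling_apply, eval]
  have h : ∀ a, x a * (M.cost s a + M.disc * ∑ s', meanKernel y a s' * v s') =
      M.cost s a * x a + M.disc / N * ∑ i, ∑ s', x a * y i a s' * v s' := by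
    intro a
    rw [mul_add, mul_comm (x a)]
    congr 1
    simp only [meanKernel, Pi.smul_apply, Finset.sum_apply, smul_eq_mul, Finset.mul_sum,
      Finset.sum_mul]
    rw [Finset.sum_comm]
    exact Finset.sum_congr rfl fun i _ => Finset.sum_congr rfl fun s' _ => by ring
  rw [Finset.sum_congr rfl fun a _ => h a, Finset.sum_add_distrib, ← Finset.mul_sum,
    Finset.sum_comm]

lemma sum_gradX (v : Fin S → ℝ) (s : Fin S) (y : Fin N → Kern S A) (c : ℝ) (z : Fin A → ℝ) :
    ∑ a, (c • M.gradX v s y) a * z a = c * (M.costLin s z + M.coupling v z y) := by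
  rw [← eval_meanKernel, eval, Finset.mul_sum]
  refine Finset.sum_congr rfl fun a _ => ?_
  have : ∑ s', meanKernel y a s' * v s' = (N : ℝ)⁻¹ * ∑ i, ∑ s', y i a s' * v s' := by
    simp only [meanKernel, Pi.smul_apply, Finset.sum_apply, smul_eq_mul, Finset.mul_sum,
      Finset.sum_mul]
    rw [Finset.sum_comm]
    exact Finset.sum_congr rfl fun i _ => Finset.sum_congr rfl fun s' _ => by ring
  rw [this, Pi.smul_apply, gradX, smul_eq_mul]
  ring

lemma sum_gradY (v : Fin S → ℝ) (x₁ x₀ : Fin A → ℝ) (c : ℝ) (z : Fin N → Kern S A) :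
    ∑ i, ∑ a, ∑ s', (c • M.gradY v x₁ x₀) i a s' * z i a s' =
      c * M.coupling v ((2 : ℝ) • x₁ - x₀) z := by
  rw [coupling_apply]
  simp only [gradY, Pi.smul_apply, Pi.sub_apply, smul_eq_mul, Finset.mul_sum]
  exact Finset.sum_congr rfl fun i _ => Finset.sum_congr rfl fun a _ =>
    Finset.sum_congr rfl fun s' _ => by ring

lemma l2norm_nonneg (v : Fin S → ℝ) : 0 ≤ l2norm v := Real.sqrt_nonneg _

/-- The step sizes satisfy `τ σ ‖K‖² ≤ 1` for the coupling `K`, in the form of a Young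
inequality. -/
lemma abs_coupling_le (hA : 1 ≤ A) (hN : 1 ≤ N) (v : Fin S → ℝ) (x x' : Fin A → ℝ)
    (y y' : Fin N → Kern S A) :
    |M.coupling v (x - x') (y - y')| ≤ divX x x' / M.stepX v + divY y y' / M.stepY v := by
  have hl := M.disc_pos
  have hV := l2norm_nonneg v
  have hAs : 0 < Real.sqrt A := Real.sqrt_pos.2 (by positivity)
  have hNp : 0 < (N : ℝ) := by positivity
  set α := Real.sqrt A
  set V := l2norm v
  have hterm : ∀ i a, |∑ s', (x - x') a * (y - y') i a s' * v s'| ≤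
      V * (α / 2 * (x a - x' a) ^ 2 + (2 * α)⁻¹ * ∑ s', (y i a s' - y' i a s') ^ 2) := by
    intro i a
    set q := Real.sqrt (∑ s', (y i a s' - y' i a s') ^ 2)
    have hq : q ^ 2 = ∑ s', (y i a s' - y' i a s') ^ 2 := Real.sq_sqrt (by positivity)
    have hcs : |∑ s', (y i a s' - y' i a s') * v s'| ≤ q * V := by
      refine abs_le_of_sq_le_sq ?_ (by positivity)
      rw [mul_pow, hq, show V ^ 2 = ∑ s', v s' ^ 2 from Real.sq_sqrt (by positivity)]
      exact Finset.sum_mul_sq_le_sq_mul_sq _ _ _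
    have e : ∑ s', (x - x') a * (y - y') i a s' * v s' =
        (x a - x' a) * ∑ s', (y i a s' - y' i a s') * v s' := by
      simp only [Pi.sub_apply, Finset.mul_sum, mul_assoc]
    rw [e, abs_mul, ← hq]
    have hy : |x a - x' a| * q ≤ α / 2 * (x a - x' a) ^ 2 + (2 * α)⁻¹ * q ^ 2 := by
      have h2 : α / 2 * (x a - x' a) ^ 2 + (2 * α)⁻¹ * q ^ 2 - |x a - x' a| * q =
          (2 * α)⁻¹ * (α * |x a - x' a| - q) ^ 2 := by
        rw [← sq_abs (x a - x' a)]
        field_simp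
        ring
      have : 0 ≤ (2 * α)⁻¹ * (α * |x a - x' a| - q) ^ 2 := by positivity
      linarith
    calc _ ≤ |x a - x' a| * (q * V) := by gcongr
      _ = V * (|x a - x' a| * q) := by ring
      _ ≤ _ := by gcongr
  rw [coupling_apply, abs_mul, abs_of_pos (by positivity)]
  calc M.disc / N * |∑ i, ∑ a, ∑ s', (x - x') a * (y - y') i a s' * v s'|
      ≤ M.disc / N * ∑ i, ∑ a,
        V * (α / 2 * (x a - x' a) ^ 2 + (2 * α)⁻¹ * ∑ s', (y i a s' - y' i a s') ^ 2) := by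
        gcongr
        refine (Finset.abs_sum_le_sum_abs _ _).trans (Finset.sum_le_sum fun i _ => ?_)
        exact (Finset.abs_sum_le_sum_abs _ _).trans (Finset.sum_le_sum fun a _ => hterm i a)
    _ = divX x x' / M.stepX v + divY y y' / M.stepY v := by
        simp only [← Finset.mul_sum, Finset.sum_add_distrib, Finset.sum_const, Finset.card_univ,
          Fintype.card_fin, nsmul_eq_mul]
        simp only [divX, divY, stepX, stepY, ← Finset.mul_sum, div_eq_mul_inv, mul_inv, inv_inv]
        rw [show Real.sqrt A = α from rfl, show l2norm v = V from rfl]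
        field_simp

/-- The saddle function of a state, at the value vector `v`. -/
def saddle (v : Fin S → ℝ) (s : Fin S) (x : Fin A → ℝ) (y : Fin N → Kern S A) : ℝ :=
  M.eval x (meanKernel y) v s

lemma saddle_eq (v : Fin S → ℝ) (s : Fin S) (x : Fin A → ℝ) (y : Fin N → Kern S A) :
    M.saddle v s x y = M.costLin s x + M.coupling v x y := M.eval_meanKernel v s x y

/-- The Lyapunov function of the primal-dual method, relative to a comparator `(x, y)`. -/
def energy (v : Fin S → ℝ) (x x' : Fin A → ℝ) (y y' : Fin N → Kern S A) : ℝ :=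
  divX x x' / M.stepX v + divY y y' / M.stepY v - M.coupling v (x - x') (y - y')

lemma energy_nonneg (hA : 1 ≤ A) (hN : 1 ≤ N) (v : Fin S → ℝ) (x x' : Fin A → ℝ)
    (y y' : Fin N → Kern S A) : 0 ≤ M.energy v x x' y y' :=
  sub_nonneg.2 ((le_abs_self _).trans (M.abs_coupling_le hA hN v x x' y y'))

lemma energy_le (hA : 1 ≤ A) (hN : 1 ≤ N) (v : Fin S → ℝ) (x x' : Fin A → ℝ)
    (y y' : Fin N → Kern S A) :
    M.energy v x x' y y' ≤ 2 * (divX x x' / M.stepX v + divY y y' / M.stepY v) := by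
  have := (neg_le_abs _).trans (M.abs_coupling_le hA hN v x x' y y')
  unfold energy
  linarith

lemma l2norm_pos {v : Fin S → ℝ} (hv : v ≠ 0) : 0 < l2norm v := by
  obtain ⟨s, hs⟩ := Function.ne_iff.1 hv
  refine Real.sqrt_pos.2 (lt_of_lt_of_le (by have : v s ≠ 0 := hs; positivity : 0 < v s ^ 2) ?_)
  exact Finset.single_le_sum (f := fun s => v s ^ 2) (fun _ _ => sq_nonneg _) (Finset.mem_univ s)

lemma stepX_pos (hA : 1 ≤ A) {v : Fin S → ℝ} (hv : v ≠ 0) : 0 < M.stepX v := by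
  have := M.disc_pos
  have := l2norm_pos hv
  have : 0 < Real.sqrt A := Real.sqrt_pos.2 (by positivity)
  unfold stepX; positivity

lemma stepY_pos (hA : 1 ≤ A) (hN : 1 ≤ N) {v : Fin S → ℝ} (hv : v ≠ 0) : 0 < M.stepY v := by
  have := M.disc_pos
  have := l2norm_pos hv
  have : 0 < Real.sqrt A := Real.sqrt_pos.2 (by positivity)
  unfold stepY; positivity

/-- One iteration of the primal-dual method bounds the gap against any comparator by the decrease
of the energy. -/
lemma saddle_sub_le_energy_sub (hA : 1 ≤ A) (hN : 1 ≤ N) {v : Fin S → ℝ} (hv : v ≠ 0) (s : Fin S)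
    {x₀ x₁ : Fin A → ℝ} {y₀ y₁ : Fin N → Kern S A}
    (hx : IsProxX (M.stepX v • M.gradX v s y₀) x₀ x₁)
    (hy : M.IsProxY s (M.stepY v • M.gradY v x₁ x₀) y₀ y₁)
    {x : Fin A → ℝ} {y : Fin N → Kern S A} (hxm : x ∈ stdSimplex ℝ (Fin A))
    (hym : y ∈ M.tuples s) :
    M.saddle v s x₁ y - M.saddle v s x y₁ ≤ M.energy v x x₀ y y₀ - M.energy v x x₁ y y₁ := by
  have hτ := M.stepX_pos hA hv
  have hσ := M.stepY_pos hA hN hv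
  set τ := M.stepX v
  set σ := M.stepY v
  have h1 := three_point (convex_stdSimplex ℝ (Fin A)) (D := divX) (x' := x₀)
    (f := fun z => ∑ a, (τ • M.gradX v s y₀) a * z a)
    (fun u w η => by
      simp only [sum_gradX, map_add, map_smul, map_sub, LinearMap.add_apply, LinearMap.smul_apply,
        LinearMap.sub_apply, smul_eq_mul]
      ring) (fun u w η => divX_segment u w x₀ η) hx.1 hx.2 hxm
  have h2 := three_point (M.convex_tuples s) (D := divY) (x' := y₀)
    (f := fun z => -∑ i, ∑ a, ∑ s', (σ • M.gradY v x₁ x₀) i a s' * z i a s')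
    (fun u w η => by
      simp only [sum_gradY, map_add, map_smul, map_sub, smul_eq_mul]
      ring) (fun u w η => divY_segment u w y₀ η) hy.1
    (by
      intro z hz
      have := hy.2 hz
      simp only [Set.mem_ofPred_eq] at this ⊢
      linarith) hym
  simp only [sum_gradX, sum_gradY] at h1 h2
  have hc := (le_abs_self _).trans (M.abs_coupling_le hA hN v x₁ x₀ y₁ y₀)
  have h1' : M.costLin s x₁ + M.coupling v x₁ y₀ + divX x₁ x₀ / τ + divX x x₁ / τ ≤
      M.costLin s x + M.coupling v x y₀ + divX x x₀ / τ := by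
    rw [← sub_nonneg] at h1 ⊢
    have := div_nonneg h1 hτ.le
    refine this.trans_eq ?_
    field_simp
  have h2' : -M.coupling v ((2 : ℝ) • x₁ - x₀) y₁ + divY y₁ y₀ / σ + divY y y₁ / σ ≤
      -M.coupling v ((2 : ℝ) • x₁ - x₀) y + divY y y₀ / σ := by
    rw [← sub_nonneg] at h2 ⊢
    have := div_nonneg h2 hσ.le
    refine this.trans_eq ?_
    field_simp
  simp only [saddle_eq, energy]
  simp only [map_sub, map_smul, LinearMap.sub_apply, LinearMap.smul_apply, smul_eq_mul]
    at hc h1' h2' ⊢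
  linarith

end Model

/-! ### Epochs and linear averages -/

lemma epochStart_one : epochStart 1 = 0 := by simp [epochStart]

lemma epochStart_succ {ℓ : ℕ} (hℓ : 1 ≤ ℓ) : epochStart (ℓ + 1) = epochStart ℓ + ℓ ^ 2 := by
  rw [epochStart, Finset.sum_Ico_succ_top hℓ, epochStart]

lemma exists_epoch (t : ℕ) : ∃ ℓ, 1 ≤ ℓ ∧ epochStart ℓ ≤ t ∧ t < epochStart (ℓ + 1) := by
  induction t with
  | zero => exact ⟨1, le_rfl, by simp [epochStart], by simp [epochStart]⟩
  | succ t ih =>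
    obtain ⟨ℓ, h1, h2, h3⟩ := ih
    rcases Nat.lt_or_ge (t + 1) (epochStart (ℓ + 1)) with h | h
    · exact ⟨ℓ, h1, by omega, h⟩
    · refine ⟨ℓ + 1, by omega, h, ?_⟩
      have hpos : 0 < (ℓ + 1) ^ 2 := by positivity
      rw [epochStart_succ (by omega)]
      omega

lemma pow_three_le_epochStart (ℓ : ℕ) : ℓ ^ 3 ≤ 3 * epochStart (ℓ + 1) := by
  induction ℓ with
  | zero => simp
  | succ n ih =>
    rw [epochStart_succ (by omega)]
    nlinarith

/-- An epoch started before iteration `T` has an index of order at most `T^{1/3}`. -/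
lemma epoch_index_le {ℓ T : ℕ} (hT : 1 ≤ T) (h : epochStart ℓ < T) :
    (ℓ : ℝ) ≤ 3 * (T : ℝ) ^ (1 / 3 : ℝ) := by
  have hcube : ℓ ^ 3 ≤ 27 * T := by
    rcases ℓ with _ | _ | n
    · simp
    · omega
    · have h1 := pow_three_le_epochStart (n + 1)
      have h2 : (n + 1 + 1) ^ 3 ≤ (2 * (n + 1)) ^ 3 := Nat.pow_le_pow_left (by omega) 3
      have h3 : (2 * (n + 1)) ^ 3 = 8 * (n + 1) ^ 3 := by ring
      omega
  have hcube' : (ℓ : ℝ) ^ 3 ≤ (3 * (T : ℝ) ^ (1 / 3 : ℝ)) ^ 3 := by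
    have e : ((T : ℝ) ^ (1 / 3 : ℝ)) ^ 3 = T := by
      rw [← Real.rpow_natCast, ← Real.rpow_mul (Nat.cast_nonneg T)]
      norm_num
    rw [mul_pow, e]
    norm_num
    exact_mod_cast hcube
  exact le_of_pow_le_pow_left₀ (by norm_num) (by positivity) hcube'

lemma sum_Ioc_cast {a b : ℕ} (hab : a ≤ b) :
    ∑ u ∈ Finset.Ioc a b, (u : ℝ) = ((b : ℝ) * (b + 1) - a * (a + 1)) / 2 := by
  induction b, hab using Nat.le_induction with
  | base => simp
  | succ b hb ih =>
    rw [Finset.sum_Ioc_succ_top hb, ih]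
    push_cast
    ring

lemma sum_Ioc_cast_pos {a b : ℕ} (hab : a < b) : 0 < ∑ u ∈ Finset.Ioc a b, (u : ℝ) := by
  refine Finset.sum_pos (fun u hu => ?_) ⟨b, by simp [hab]⟩
  have := (Finset.mem_Ioc.1 hu).1
  exact_mod_cast (by omega : 0 < u)

lemma linAvg_mem {E : Type*} [AddCommGroup E] [Module ℝ E] {C : Set E} (hC : Convex ℝ C)
    {a b : ℕ} (hab : a < b) {z : ℕ → E} (hz : ∀ t, z t ∈ C) : linAvg a b z ∈ C := by
  refine hC.sum_mem (fun t _ => by positivity) ?_ fun t _ => hz t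
  rw [← Finset.sum_div, div_self (sum_Ioc_cast_pos hab).ne']

lemma map_linAvg {E : Type*} [AddCommGroup E] [Module ℝ E] {a b : ℕ} (hab : a < b) (z : ℕ → E)
    (f : E →ₗ[ℝ] ℝ) : (∑ u ∈ Finset.Ioc a b, (u : ℝ)) * f (linAvg a b z) =
      ∑ t ∈ Finset.Ioc a b, (t : ℝ) * f (z t) := by
  have h := (sum_Ioc_cast_pos hab).ne'
  rw [linAvg, map_sum, Finset.mul_sum]
  refine Finset.sum_congr rfl fun t _ => ?_
  rw [map_smul, smul_eq_mul]
  field_simp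

/-- The recursion `r_{ℓ+1} ≤ λ r_ℓ + O(ℓ⁻²)` with `λ < 1` forces `r_ℓ = O(ℓ⁻²)`. -/
lemma exists_recursion_constant {disc : ℝ} (h0 : 0 < disc) (h1 : disc < 1) :
    ∃ C : ℝ, 0 ≤ C ∧ ∀ (r : ℕ → ℝ) (B : ℝ), 0 ≤ B → r 1 ≤ B →
      (∀ ℓ, 1 ≤ ℓ → r (ℓ + 1) ≤ disc * r ℓ + B / (ℓ : ℝ) ^ 2) →
      ∀ ℓ, 1 ≤ ℓ → r ℓ ≤ C * B / (ℓ : ℝ) ^ 2 := by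
  -- After a shift of the index by `m`, the ratio `q` of consecutive terms of `(ℓ + m)⁻²` is so
  -- close to `1` that `λ q < 1`.
  obtain ⟨m, hm⟩ := exists_nat_gt (3 / (1 - disc))
  have hd : 0 < 1 - disc := by linarith
  have hm0 : 0 < (m : ℝ) := lt_trans (by positivity) hm
  have hm3 : 3 < m * (1 - disc) := by rwa [div_lt_iff₀ hd] at hm
  have hm1 : 1 ≤ (m : ℝ) := by
    have : 0 < m := by exact_mod_cast hm0
    exact_mod_cast this
  set q : ℝ := (((m : ℝ) + 1) / m) ^ 2 with hq
  have hq1 : disc * q < 1 := by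
    rw [hq, div_pow, ← mul_div_assoc, div_lt_one (by positivity)]
    nlinarith
  have hqpos : 0 < q := by positivity
  set C : ℝ := ((m : ℝ) + 1) ^ 2 * (1 + q / (1 - disc * q)) with hC
  have hden : 0 < 1 - disc * q := by linarith
  have hC0 : 0 ≤ C := by positivity
  have hCm : ((m : ℝ) + 1) ^ 2 ≤ C := by
    rw [hC]
    have : 0 ≤ ((m : ℝ) + 1) ^ 2 * (q / (1 - disc * q)) := by positivity
    linarith
  have hCq : q * (disc * C + ((m : ℝ) + 1) ^ 2) ≤ C := by
    have e : C * (1 - disc * q) = ((m : ℝ) + 1) ^ 2 * (1 - disc * q + q) := by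
      rw [hC, mul_assoc, add_mul, div_mul_cancel₀ _ hden.ne', one_mul]
    have : 0 ≤ ((m : ℝ) + 1) ^ 2 * (1 - disc * q) := by positivity
    linarith
  refine ⟨C, hC0, fun r B hB hr1 hrec => ?_⟩
  have key : ∀ ℓ : ℕ, 1 ≤ ℓ → r ℓ ≤ C * B / ((ℓ : ℝ) + m) ^ 2 := by
    intro ℓ hℓ
    induction ℓ, hℓ using Nat.le_induction with
    | base =>
      rw [le_div_iff₀ (by positivity)]
      push_cast
      calc r 1 * (1 + m) ^ 2 ≤ B * (1 + m) ^ 2 := by gcongr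
        _ = ((m : ℝ) + 1) ^ 2 * B := by ring
        _ ≤ C * B := by gcongr
    | succ ℓ hℓ ih =>
      have hℓ' : 1 ≤ (ℓ : ℝ) := by exact_mod_cast hℓ
      have hb : B / (ℓ : ℝ) ^ 2 ≤ ((m : ℝ) + 1) ^ 2 * B / ((ℓ : ℝ) + m) ^ 2 := by
        rw [div_le_div_iff₀ (by positivity) (by positivity)]
        have : ((ℓ : ℝ) + m) ^ 2 ≤ (((m : ℝ) + 1) * ℓ) ^ 2 := by
          gcongr
          nlinarith
        calc B * ((ℓ : ℝ) + m) ^ 2 ≤ B * (((m : ℝ) + 1) * ℓ) ^ 2 := by gcongr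
          _ = _ := by ring
      have hqℓ : ((ℓ : ℝ) + 1 + m) ^ 2 ≤ q * ((ℓ : ℝ) + m) ^ 2 := by
        rw [hq, ← mul_pow]
        gcongr
        rw [div_mul_eq_mul_div, le_div_iff₀ hm0]
        nlinarith
      calc r (ℓ + 1) ≤ disc * r ℓ + B / (ℓ : ℝ) ^ 2 := hrec ℓ hℓ
        _ ≤ disc * (C * B / ((ℓ : ℝ) + m) ^ 2) + ((m : ℝ) + 1) ^ 2 * B / ((ℓ : ℝ) + m) ^ 2 := by
            gcongr
        _ = (disc * C + ((m : ℝ) + 1) ^ 2) * B / ((ℓ : ℝ) + m) ^ 2 := by ring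
        _ ≤ C * B / (((ℓ + 1 : ℕ) : ℝ) + m) ^ 2 := by
            push_cast
            rw [div_le_div_iff₀ (by positivity) (by positivity)]
            calc (disc * C + ((m : ℝ) + 1) ^ 2) * B * ((ℓ : ℝ) + 1 + m) ^ 2
                ≤ (disc * C + ((m : ℝ) + 1) ^ 2) * B * (q * ((ℓ : ℝ) + m) ^ 2) := by gcongr
              _ = q * (disc * C + ((m : ℝ) + 1) ^ 2) * (B * ((ℓ : ℝ) + m) ^ 2) := by ring
              _ ≤ C * (B * ((ℓ : ℝ) + m) ^ 2) := by gcongr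
              _ = _ := by ring
  intro ℓ hℓ
  have hℓ' : 1 ≤ (ℓ : ℝ) := by exact_mod_cast hℓ
  refine (key ℓ hℓ).trans ?_
  gcongr
  linarith

namespace Model

variable (M : Model S A N)

/-! ### Widths, norms and step sizes -/

lemma divX_le_widthX {x x' : Fin A → ℝ} (hx : x ∈ stdSimplex ℝ (Fin A))
    (hx' : x' ∈ stdSimplex ℝ (Fin A)) : divX x x' ≤ widthX A := by
  refine le_csSup ?_ ⟨(x, x'), ⟨hx, hx'⟩, rfl⟩
  refine (((isCompact_stdSimplex ℝ (Fin A)).prod (isCompact_stdSimplex ℝ (Fin A))).image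
    ?_).bddAbove
  unfold divX
  fun_prop

lemma divY_le_widthY {s : Fin S} {y y' : Fin N → Kern S A} (hy : y ∈ M.tuples s)
    (hy' : y' ∈ M.tuples s) : divY y y' ≤ M.widthY := by
  refine le_trans ?_ (le_ciSup (Set.finite_range _).bddAbove s)
  refine le_csSup ?_ ⟨(y, y'), ⟨hy, hy'⟩, rfl⟩
  refine (((M.isCompact_tuples s).prod (M.isCompact_tuples s)).image ?_).bddAbove
  unfold divY
  fun_prop

lemma widthX_nonneg (hA : 1 ≤ A) : 0 ≤ widthX A := by
  have h := single_mem_stdSimplex ℝ (⟨0, hA⟩ : Fin A)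
  exact (divX_nonneg _ _).trans (divX_le_widthX h h)

lemma widthY_nonneg (hS : 1 ≤ S) (hN : 1 ≤ N) : 0 ≤ M.widthY := by
  have h := M.nominal_mem_tuples hN ⟨0, hS⟩
  exact (divY_nonneg _ _).trans (M.divY_le_widthY h h)

lemma one_le_widthX (hA : 2 ≤ A) : 1 ≤ widthX A := by
  set i : Fin A := ⟨0, by omega⟩
  set j : Fin A := ⟨1, by omega⟩
  have hij : i ≠ j := by simp [i, j]
  refine le_trans (le_of_eq ?_) (divX_le_widthX (single_mem_stdSimplex ℝ i)
    (single_mem_stdSimplex ℝ j))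
  have : ∀ a, ((Pi.single i 1 : Fin A → ℝ) a - (Pi.single j 1 : Fin A → ℝ) a) ^ 2 =
      (Pi.single i 1 : Fin A → ℝ) a + (Pi.single j 1 : Fin A → ℝ) a := by
    intro a
    by_cases h1 : a = i
    · subst h1; simp [hij]
    · by_cases h2 : a = j
      · subst h2; simp [h1]
      · simp [h1, h2]
  rw [divX, Finset.sum_congr rfl fun a _ => this a, Finset.sum_add_distrib,
    Finset.sum_pi_single', Finset.sum_pi_single']
  norm_num

/-- With a single action, a positive radius and at least two states, every nominal kernel can be
moved by a definite amount towards a vertex to which it gives probability at most `1/2`. -/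
lemma le_widthY (hA : A = 1) (hS : 2 ≤ S) (hN : 1 ≤ N) :
    N * (min 1 (M.radius / 2) ^ 2 / 8) ≤ M.widthY := by
  subst hA
  set α := min 1 (M.radius / 2) with hα
  have hα0 : 0 ≤ α := le_min zero_le_one (by linarith [M.radius_nonneg])
  have hα1 : α ≤ 1 := min_le_left _ _
  set s : Fin S := ⟨0, by omega⟩
  have hvert : ∀ i, ∃ j, M.nominal s i 0 j ≤ 1 / 2 := by
    intro i
    by_contra hcon
    push Not at hcon
    have h := M.nominal_mem s i 0
    set j₀ : Fin S := ⟨0, by omega⟩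
    set j₁ : Fin S := ⟨1, by omega⟩
    have hne : j₀ ≠ j₁ := by simp [j₀, j₁]
    have h2 : M.nominal s i 0 j₀ + M.nominal s i 0 j₁ ≤ 1 := by
      rw [← h.2, ← Finset.sum_pair hne]
      exact Finset.sum_le_univ_sum_of_nonneg fun j => h.1 j
    linarith [hcon j₀, hcon j₁]
  choose j hj using hvert
  set e : Fin N → Kern S 1 := fun i _ => Pi.single (j i) 1
  have he : ∀ i, e i ∈ kernels S 1 := fun i _ => single_mem_stdSimplex ℝ (j i)
  set y : Fin N → Kern S 1 := fun i => M.nominal s i + α • (e i - M.nominal s i)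
  have hy : y ∈ M.tuples s := by
    refine M.mem_tuples_of_d_le hN s
      (fun i => convex_kernels.add_smul_sub_mem (M.nominal_mem s i) (he i) ⟨hα0, hα1⟩) fun i => ?_
    rw [BaseMetric.d_eq_sub, add_sub_cancel_left, BaseMetric.d_smul, ← BaseMetric.d_eq_sub,
      abs_of_nonneg hα0]
    calc α * M.metric.d (e i) (M.nominal s i) ≤ M.radius / 2 * 2 := by
          gcongr
          · exact M.metric.d_nonneg _ _
          · linarith [M.radius_nonneg]
          · exact min_le_right _ _
          · exact M.metric.d_le_two rfl (he i) (M.nominal_mem s i)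
      _ = M.radius := by ring
  refine le_trans ?_ (M.divY_le_widthY hy (M.nominal_mem_tuples hN s))
  have hterm : ∀ i, α ^ 2 / 8 ≤
      1 / 2 * ∑ a, ∑ s', (y i a s' - M.nominal s i a s') ^ 2 := by
    intro i
    have h1 : (y i 0 (j i) - M.nominal s i 0 (j i)) ^ 2 ≤
        ∑ s', (y i 0 s' - M.nominal s i 0 s') ^ 2 :=
      Finset.single_le_sum (f := fun s' => (y i 0 s' - M.nominal s i 0 s') ^ 2)
        (fun _ _ => sq_nonneg _) (Finset.mem_univ (j i))
    have h2 : y i 0 (j i) - M.nominal s i 0 (j i) = α * (1 - M.nominal s i 0 (j i)) := by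
      simp [y, e]
    have h3 : (α * (1 / 2)) ^ 2 ≤ (α * (1 - M.nominal s i 0 (j i))) ^ 2 := by
      gcongr
      linarith [hj i]
    rw [h2] at h1
    simp only [Finset.univ_unique, Fin.default_eq_zero, Fin.isValue, Finset.sum_singleton]
    nlinarith
  calc N * (α ^ 2 / 8) = ∑ _i : Fin N, α ^ 2 / 8 := by simp
    _ ≤ _ := Finset.sum_le_sum fun i _ => hterm i

lemma stepTerm_eq (v : Fin S → ℝ) : M.stepTerm v =
    (widthX A * (Real.sqrt A * M.disc) + M.widthY * ((N : ℝ)⁻¹ * (Real.sqrt A)⁻¹ * M.disc)) *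
      l2norm v := by
  simp only [stepTerm, stepX, stepY, div_eq_mul_inv, mul_inv, inv_inv]
  ring

lemma stepTerm_nonneg (hS : 1 ≤ S) (hA : 1 ≤ A) (hN : 1 ≤ N) (v : Fin S → ℝ) :
    0 ≤ M.stepTerm v := by
  have := widthX_nonneg hA
  have := M.widthY_nonneg hS hN
  have := M.disc_pos
  have := l2norm_nonneg v
  rw [stepTerm_eq]
  positivity

lemma norm_le_l2norm (v : Fin S → ℝ) : ‖v‖ ≤ l2norm v := by
  rw [pi_norm_le_iff_of_nonneg (l2norm_nonneg v)]
  intro s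
  exact Real.abs_le_sqrt (Finset.single_le_sum (f := fun s => v s ^ 2)
    (fun _ _ => sq_nonneg _) (Finset.mem_univ s))

lemma l2norm_le (v : Fin S → ℝ) : l2norm v ≤ Real.sqrt S * ‖v‖ := by
  rw [l2norm, ← Real.sqrt_sq (norm_nonneg v), ← Real.sqrt_mul (Nat.cast_nonneg S)]
  refine Real.sqrt_le_sqrt ?_
  calc ∑ s, v s ^ 2 ≤ ∑ _s : Fin S, ‖v‖ ^ 2 := by
        refine Finset.sum_le_sum fun s _ => ?_
        rw [← sq_abs]
        gcongr
        exact norm_le_pi_norm v s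
    _ = _ := by simp

lemma disc_mul_norm_le_stepTerm (hS : 1 ≤ S) (hA : 2 ≤ A) (hN : 1 ≤ N) (v : Fin S → ℝ) :
    M.disc * ‖v‖ ≤ M.stepTerm v := by
  have h1 := one_le_widthX hA
  have h2 := M.widthY_nonneg hS hN
  have h3 := M.disc_pos
  have h4 : 1 ≤ Real.sqrt A := Real.one_le_sqrt.2 (by exact_mod_cast (by omega : 1 ≤ A))
  rw [stepTerm_eq]
  gcongr
  · have : 0 ≤ M.widthY * ((N : ℝ)⁻¹ * (Real.sqrt A)⁻¹ * M.disc) := by positivity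
    have : 1 * (1 * M.disc) ≤ widthX A * (Real.sqrt A * M.disc) := by gcongr
    linarith
  · exact norm_le_l2norm v

lemma radius_mul_norm_le_stepTerm (hA : A = 1) (hS : 2 ≤ S) (hN : 1 ≤ N) (v : Fin S → ℝ) :
    M.disc * (min 1 (M.radius / 2) ^ 2 / 8) * ‖v‖ ≤ M.stepTerm v := by
  have h1 := widthX_nonneg (A := A) (by omega)
  have h2 := M.le_widthY hA hS hN
  have h3 := M.disc_pos
  have hN' : 0 < (N : ℝ) := by positivity
  have hY := M.widthY_nonneg (by omega) hN
  rw [stepTerm_eq]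
  gcongr
  · have : 0 ≤ widthX A * (Real.sqrt A * M.disc) := by positivity
    have : M.disc * (min 1 (M.radius / 2) ^ 2 / 8) ≤
        M.widthY * ((N : ℝ)⁻¹ * (Real.sqrt A)⁻¹ * M.disc) := by
      calc M.disc * (min 1 (M.radius / 2) ^ 2 / 8)
          = N * (min 1 (M.radius / 2) ^ 2 / 8) * ((N : ℝ)⁻¹ * (Real.sqrt A)⁻¹ * M.disc) := by
            simp only [hA, Nat.cast_one, Real.sqrt_one, inv_one, mul_one]
            field_simp
        _ ≤ _ := by gcongr
    linarith
  · exact norm_le_l2norm v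

lemma one_le_RX (hA : 1 ≤ A) : 1 ≤ RX A := by
  refine le_csSup ?_ ⟨Pi.single ⟨0, hA⟩ 1, single_mem_stdSimplex ℝ _, ?_⟩
  · exact ((isCompact_stdSimplex ℝ (Fin A)).image (by fun_prop)).bddAbove
  · simp [Pi.single_apply]

/-- The factor `(√S / √N) R_X R_Y` is at least `1`, since the squared Euclidean norm of a
distribution on `S` states is at least `1 / S`. -/
lemma one_le_prefactor (hS : 1 ≤ S) (hA : 1 ≤ A) (hN : 1 ≤ N) :
    1 ≤ Real.sqrt S / Real.sqrt N * RX A * M.RY := by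
  have hS' : 0 < (S : ℝ) := by positivity
  have hN' : 0 < (N : ℝ) := by positivity
  have hA' : 1 ≤ (A : ℝ) := by exact_mod_cast hA
  have hRY : Real.sqrt (N / S) ≤ M.RY := by
    refine le_trans ?_ (le_ciSup (Set.finite_range _).bddAbove (⟨0, hS⟩ : Fin S))
    refine le_trans ?_ (le_csSup ((M.isCompact_tuples _).image (by fun_prop)).bddAbove
      ⟨_, M.nominal_mem_tuples hN ⟨0, hS⟩, rfl⟩)
    refine Real.sqrt_le_sqrt ?_
    have hrow : ∀ i a, 1 / (S : ℝ) ≤ ∑ s', M.nominal ⟨0, hS⟩ i a s' ^ 2 := by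
      intro i a
      have := sq_sum_le_card_mul_sum_sq (s := Finset.univ) (f := M.nominal ⟨0, hS⟩ i a)
      rw [(M.nominal_mem ⟨0, hS⟩ i a).2] at this
      rw [div_le_iff₀ hS']
      simpa [mul_comm] using this
    calc (N : ℝ) / S = ∑ _i : Fin N, 1 / (S : ℝ) := by simp [div_eq_mul_inv]
      _ ≤ ∑ _i : Fin N, A * (1 / (S : ℝ)) := by
          gcongr
          exact le_mul_of_one_le_left (by positivity) hA'
      _ = ∑ _i : Fin N, ∑ _a : Fin A, 1 / (S : ℝ) := by simp
      _ ≤ _ := Finset.sum_le_sum fun i _ => Finset.sum_le_sum fun a _ => hrow i a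
  have hRX := one_le_RX hA
  calc (1 : ℝ) = Real.sqrt S / Real.sqrt N * 1 * Real.sqrt (N / S) := by
        rw [Real.sqrt_div hN'.le]
        have := Real.sqrt_pos.2 hS'
        have := Real.sqrt_pos.2 hN'
        field_simp
    _ ≤ _ := by gcongr

/-! ### The robust Bellman equation in terms of tuples -/

/-- `F^{x,y}(v)_s` depends on `v` in a `λ`-Lipschitz way in the supremum norm. -/
lemma eval_le_eval_add {x : Fin A → ℝ} {y : Kern S A} (hx : x ∈ stdSimplex ℝ (Fin A))
    (hy : y ∈ kernels S A) (v w : Fin S → ℝ) (s : Fin S) :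
    M.eval x y v s ≤ M.eval x y w s + M.disc * ‖v - w‖ := by
  have hl := M.disc_pos
  have hrow : ∀ a, ∑ s', y a s' * v s' ≤ ∑ s', y a s' * w s' + ‖v - w‖ := by
    intro a
    calc ∑ s', y a s' * v s' ≤ ∑ s', (y a s' * w s' + y a s' * ‖v - w‖) := by
          refine Finset.sum_le_sum fun s' _ => ?_
          rw [← mul_add]
          refine mul_le_mul_of_nonneg_left ?_ ((hy a).1 s')
          have := (le_abs_self _).trans (norm_le_pi_norm (v - w) s')
          simp only [Pi.sub_apply] at this
          linarith
      _ = _ := by rw [Finset.sum_add_distrib, ← Finset.sum_mul, (hy a).2, one_mul]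
  calc M.eval x y v s ≤ ∑ a, (x a * (M.cost s a + M.disc * ∑ s', y a s' * w s') +
        x a * (M.disc * ‖v - w‖)) := by
        refine Finset.sum_le_sum fun a _ => ?_
        rw [← mul_add]
        refine mul_le_mul_of_nonneg_left ?_ (hx.1 a)
        have := mul_le_mul_of_nonneg_left (hrow a) hl.le
        linarith
    _ = _ := by rw [Finset.sum_add_distrib, ← Finset.sum_mul, hx.2, one_mul, eval]

lemma saddle_le_saddle_add (hN : 1 ≤ N) {x : Fin A → ℝ} {y : Fin N → Kern S A} {s₀ : Fin S}
    (hx : x ∈ stdSimplex ℝ (Fin A)) (hy : y ∈ M.tuples s₀) (v w : Fin S → ℝ) (s : Fin S) :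
    M.saddle v s x y ≤ M.saddle w s x y + M.disc * ‖v - w‖ :=
  M.eval_le_eval_add hx (meanKernel_mem_kernels hN hy.1) v w s

/-- The expectation of `F^{x,y}(v)_s` is its value at the expected kernel. -/
lemma integral_eval {s : Fin S} {μ : Measure (Kern S A)} (hμ : μ ∈ M.ambiguity s)
    (x : Fin A → ℝ) (v : Fin S → ℝ) :
    ∫ y, M.eval x y v s ∂μ = M.eval x (∫ y, y ∂μ) v s := by
  have := hμ.1
  set L : Kern S A →L[ℝ] ℝ := ∑ a, (x a * M.disc) • ∑ s', v s' •
    (ContinuousLinearMap.proj (R := ℝ) (φ := fun _ : Fin S => ℝ) s').comp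
      (ContinuousLinearMap.proj (R := ℝ) (φ := fun _ : Fin A => Fin S → ℝ) a) with hL
  have hLe : ∀ y, M.eval x y v s = M.costLin s x + L y := by
    intro y
    rw [eval, costLin_apply, hL]
    simp only [sum_apply, smul_apply,
      ContinuousLinearMap.comp_apply, ContinuousLinearMap.proj_apply, smul_eq_mul,
      ← Finset.sum_add_distrib]
    refine Finset.sum_congr rfl fun a _ => ?_
    rw [mul_add, mul_comm (x a), mul_assoc]
    simp only [mul_comm (v _)]
  have hint := M.integrable_id_of_mem_ambiguity hμ
  simp only [hLe]
  rw [integral_add (integrable_const _) (L.integrable_comp hint), L.integral_comp_comm hint]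
  simp

variable {vstar : Fin S → ℝ}

/-- An optimal mixed action guarantees the value against all admissible tuples. -/
lemma exists_saddle_le_value (hN : 1 ≤ N) (hv : M.IsValueVector vstar) (s : Fin S) :
    ∃ x ∈ stdSimplex ℝ (Fin A), ∀ y ∈ M.tuples s, M.saddle vstar s x y ≤ vstar s := by
  obtain ⟨x, hx, hgr⟩ := (hv s).1
  refine ⟨x, hx, fun y hy => hgr.2 ?_⟩
  obtain ⟨μ, hμ, h⟩ := M.exists_mem_ambiguity_of_mem_tuples hN hy
  refine ⟨μ, hμ, ?_⟩
  simp only [M.integral_eval hμ, h, saddle]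

/-- No mixed action does better than the value against its worst admissible tuple. -/
lemma exists_value_le_saddle (hN : 1 ≤ N) (hv : M.IsValueVector vstar) (s : Fin S)
    {x : Fin A → ℝ} (hx : x ∈ stdSimplex ℝ (Fin A)) :
    ∃ y ∈ M.tuples s, vstar s ≤ M.saddle vstar s x y := by
  have hcont : Continuous fun y : Fin N → Kern S A => M.saddle vstar s x y := by
    simp only [saddle_eq, coupling_apply]
    fun_prop
  obtain ⟨y, hy, hmax⟩ := (M.isCompact_tuples s).exists_isMaxOn
    ⟨_, M.nominal_mem_tuples hN s⟩ hcont.continuousOn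
  refine ⟨y, hy, (hv s).2 ⟨x, hx, ?_, ?_⟩⟩
  · obtain ⟨μ, hμ, h⟩ := M.exists_mem_ambiguity_of_mem_tuples hN hy
    refine ⟨μ, hμ, ?_⟩
    simp only [M.integral_eval hμ, h, saddle]
  · rintro _ ⟨μ, hμ, rfl⟩
    obtain ⟨y', hy', h⟩ := M.exists_tuple_of_mem_ambiguity hμ
    simp only [M.integral_eval hμ, ← h]
    exact hmax hy'

/-! ### Runs of the algorithm -/

section Run

variable {M} {v : ℕ → Fin S → ℝ} {x : ℕ → Fin S → Fin A → ℝ} {y : ℕ → Fin S → Fin N → Kern S A}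

lemma IsRun.mem (hrun : M.IsRun v x y) (t : ℕ) (s : Fin S) :
    x t s ∈ stdSimplex ℝ (Fin A) ∧ y t s ∈ M.tuples s := by
  rcases t with _ | t
  · exact ⟨hrun.x_init s, hrun.y_init s⟩
  · obtain ⟨ℓ, h1, h2, h3⟩ := exists_epoch t
    rw [epochStart_succ h1] at h3
    have ht := Finset.mem_Ico.2 ⟨h2, h3⟩
    exact ⟨(hrun.x_step ℓ h1 t ht s).1, (hrun.y_step ℓ h1 t ht s).1⟩

/-- The `t`-weighted gaps of the first iterations of an epoch, up to iteration `b`, telescope to a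
bound of order `b`. -/
lemma IsRun.sum_epoch_le (hrun : M.IsRun v x y) (hA : 1 ≤ A) (hN : 1 ≤ N) {ℓ : ℕ} (hℓ : 1 ≤ ℓ)
    (hv : v ℓ ≠ 0) {s : Fin S} {x' : Fin A → ℝ} {y' : Fin N → Kern S A}
    (hx' : x' ∈ stdSimplex ℝ (Fin A)) (hy' : y' ∈ M.tuples s) {b : ℕ}
    (hab : epochStart ℓ ≤ b) (hb : b ≤ epochStart (ℓ + 1)) :
    ∑ t ∈ Finset.Ioc (epochStart ℓ) b,
      (t : ℝ) * (M.saddle (v ℓ) s (x t s) y' - M.saddle (v ℓ) s x' (y t s)) ≤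
        2 * M.stepTerm (v ℓ) * b := by
  set E : ℕ → ℝ := fun t => M.energy (v ℓ) x' (x t s) y' (y t s) with hE
  have hE0 : ∀ t, 0 ≤ E t := fun t => M.energy_nonneg hA hN _ _ _ _ _
  have hE1 : ∀ t, E t ≤ 2 * M.stepTerm (v ℓ) := by
    intro t
    refine (M.energy_le hA hN _ _ _ _ _).trans ?_
    have hτ := M.stepX_pos hA hv
    have hσ := M.stepY_pos hA hN hv
    unfold stepTerm
    gcongr
    · exact divX_le_widthX hx' (hrun.mem t s).1
    · exact M.divY_le_widthY hy' (hrun.mem t s).2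
  -- Summation by parts: with the term `b E_b` kept, passing to `b + 1` costs only `E_b`.
  suffices h : ∑ t ∈ Finset.Ioc (epochStart ℓ) b,
      (t : ℝ) * (M.saddle (v ℓ) s (x t s) y' - M.saddle (v ℓ) s x' (y t s)) + b * E b ≤
        2 * M.stepTerm (v ℓ) * b by
    have := mul_nonneg (Nat.cast_nonneg (α := ℝ) b) (hE0 b)
    linarith
  induction b, hab using Nat.le_induction with
  | base =>
    rw [Finset.Ioc_self, Finset.sum_empty, zero_add, mul_comm]
    gcongr
    exact hE1 _
  | succ b hab ih =>
    rw [Finset.sum_Ioc_succ_top hab]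
    have ht : b ∈ Finset.Ico (epochStart ℓ) (epochStart ℓ + ℓ ^ 2) := by
      rw [← epochStart_succ hℓ]
      exact Finset.mem_Ico.2 ⟨hab, hb⟩
    have hstep := M.saddle_sub_le_energy_sub hA hN hv s (hrun.x_step ℓ hℓ b ht s)
      (hrun.y_step ℓ hℓ b ht s) hx' hy'
    have h1 := mul_le_mul_of_nonneg_left hstep (Nat.cast_nonneg (α := ℝ) (b + 1))
    have h2 := ih (by omega)
    have h3 := hE1 b
    push_cast at h1 ⊢
    simp only [hE] at h2 h3 ⊢
    linarith

/-- The gap of linear averages is the weighted average of the gaps. -/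
lemma saddle_linAvg (w : Fin S → ℝ) (s : Fin S) {a b : ℕ} (hab : a < b) (X : ℕ → Fin A → ℝ)
    (Y : ℕ → Fin N → Kern S A) (x' : Fin A → ℝ) (y' : Fin N → Kern S A) :
    (∑ u ∈ Finset.Ioc a b, (u : ℝ)) *
        (M.saddle w s (linAvg a b X) y' - M.saddle w s x' (linAvg a b Y)) =
      ∑ t ∈ Finset.Ioc a b, (t : ℝ) * (M.saddle w s (X t) y' - M.saddle w s x' (Y t)) := by
  have h1 := map_linAvg hab X (M.costLin s + (M.coupling w).flip y')
  have h2 := map_linAvg hab Y (M.coupling w x')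
  simp only [LinearMap.add_apply, LinearMap.flip_apply] at h1
  simp only [saddle_eq, mul_sub, Finset.sum_sub_distrib]
  rw [h1]
  simp only [mul_add, Finset.sum_add_distrib]
  rw [h2, Finset.sum_mul]

/-- The averages of epoch `ℓ` form an `O(ℓ⁻²)`-approximate saddle point. -/
lemma IsRun.epoch_gap_le (hrun : M.IsRun v x y) (hA : 1 ≤ A) (hN : 1 ≤ N) {ℓ : ℕ} (hℓ : 1 ≤ ℓ)
    (hv : v ℓ ≠ 0) {s : Fin S} {x' : Fin A → ℝ} {y' : Fin N → Kern S A}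
    (hx' : x' ∈ stdSimplex ℝ (Fin A)) (hy' : y' ∈ M.tuples s) :
    M.saddle (v ℓ) s (linAvg (epochStart ℓ) (epochStart ℓ + ℓ ^ 2) fun t => x t s) y' -
      M.saddle (v ℓ) s x' (linAvg (epochStart ℓ) (epochStart ℓ + ℓ ^ 2) fun t => y t s) ≤
        4 * M.stepTerm (v ℓ) / (ℓ : ℝ) ^ 2 := by
  have hpos : 0 < ℓ ^ 2 := by positivity
  have hab : epochStart ℓ < epochStart ℓ + ℓ ^ 2 := by omega
  have h1 := hrun.sum_epoch_le hA hN hℓ hv hx' hy' hab.le (epochStart_succ hℓ).ge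
  rw [← saddle_linAvg (v ℓ) s hab (fun t => x t s) (fun t => y t s) x' y', sum_Ioc_cast hab.le]
    at h1
  set g := M.saddle (v ℓ) s (linAvg (epochStart ℓ) (epochStart ℓ + ℓ ^ 2) fun t => x t s) y' -
      M.saddle (v ℓ) s x' (linAvg (epochStart ℓ) (epochStart ℓ + ℓ ^ 2) fun t => y t s)
  have hℓ' : 0 < (ℓ : ℝ) := by positivity
  rw [le_div_iff₀ (by positivity)]
  by_cases hg : g ≤ 0
  · have : 0 ≤ M.stepTerm (v ℓ) := M.stepTerm_nonneg (by have := s.isLt; omega) hA hN _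
    have : g * (ℓ : ℝ) ^ 2 ≤ 0 := mul_nonpos_of_nonpos_of_nonneg hg (by positivity)
    linarith
  · push Not at hg
    push_cast at h1
    set a : ℝ := (epochStart ℓ : ℝ)
    have ha : 0 ≤ a := Nat.cast_nonneg _
    have hbpos : 0 < a + (ℓ : ℝ) ^ 2 := by positivity
    refine le_of_mul_le_mul_right (a := a + (ℓ : ℝ) ^ 2) ?_ hbpos
    have h2 : (ℓ : ℝ) ^ 2 * (a + (ℓ : ℝ) ^ 2) ≤
        (a + (ℓ : ℝ) ^ 2) * (a + (ℓ : ℝ) ^ 2 + 1) - a * (a + 1) := by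
      have : 0 ≤ (ℓ : ℝ) ^ 2 * (a + 1) := by positivity
      linarith
    have h3 := mul_le_mul_of_nonneg_left h2 hg.le
    linarith

/-- One epoch contracts the distance to the value vector, up to the accuracy of the epoch. -/
lemma IsRun.norm_value_sub_le (hrun : M.IsRun v x y) (hS : 1 ≤ S) (hA : 1 ≤ A) (hN : 1 ≤ N)
    (hvs : M.IsValueVector vstar) {ℓ : ℕ} (hℓ : 1 ≤ ℓ) (hv : v ℓ ≠ 0) :
    ‖v (ℓ + 1) - vstar‖ ≤ M.disc * ‖v ℓ - vstar‖ + 4 * M.stepTerm (v ℓ) / (ℓ : ℝ) ^ 2 := by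
  have hl := M.disc_pos
  have hT := M.stepTerm_nonneg hS hA hN (v ℓ)
  rw [pi_norm_le_iff_of_nonneg (by positivity)]
  intro s
  have hpos : 0 < ℓ ^ 2 := by positivity
  have hab : epochStart ℓ < epochStart ℓ + ℓ ^ 2 := by omega
  set X := linAvg (epochStart ℓ) (epochStart ℓ + ℓ ^ 2) fun t => x t s with hX
  set Y := linAvg (epochStart ℓ) (epochStart ℓ + ℓ ^ 2) fun t => y t s with hY
  have hXm : X ∈ stdSimplex ℝ (Fin A) :=
    linAvg_mem (convex_stdSimplex ℝ _) hab fun t => (hrun.mem t s).1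
  have hYm : Y ∈ M.tuples s := linAvg_mem (M.convex_tuples s) hab fun t => (hrun.mem t s).2
  have hvs' : v (ℓ + 1) s = M.saddle (v ℓ) s X Y := hrun.v_step ℓ hℓ s
  obtain ⟨xo, hxo, hxo'⟩ := M.exists_saddle_le_value hN hvs s
  obtain ⟨yo, hyo, hyo'⟩ := M.exists_value_le_saddle hN hvs s hXm
  have h1 := hrun.epoch_gap_le hA hN hℓ hv hxo hYm
  have h2 := hrun.epoch_gap_le hA hN hℓ hv hXm hyo
  have h3 := M.saddle_le_saddle_add hN hxo hYm (v ℓ) vstar s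
  have h4 := M.saddle_le_saddle_add hN hXm hyo vstar (v ℓ) s
  rw [norm_sub_rev] at h4
  have h5 := hxo' Y hYm
  rw [Pi.sub_apply, hvs', Real.norm_eq_abs, abs_le]
  constructor <;> linarith

/-- The value vectors of a run are bounded. -/
lemma IsRun.exists_norm_le (hrun : M.IsRun v x y) (hN : 1 ≤ N) :
    ∃ B, ∀ ℓ, 1 ≤ ℓ → ‖v ℓ‖ ≤ B := by
  have hl := M.disc_pos
  have hl1 : 0 < 1 - M.disc := by linarith [M.disc_lt_one]
  set c : ℝ := ‖M.cost‖
  refine ⟨max ‖v 1‖ (c / (1 - M.disc)), fun ℓ hℓ => ?_⟩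
  set B := max ‖v 1‖ (c / (1 - M.disc)) with hB
  have hB0 : 0 ≤ B := (norm_nonneg _).trans (le_max_left _ _)
  have hc : c + M.disc * B ≤ B := by
    have : c / (1 - M.disc) ≤ B := le_max_right _ _
    rw [div_le_iff₀ hl1] at this
    linarith
  induction ℓ, hℓ using Nat.le_induction with
  | base => exact le_max_left _ _
  | succ ℓ hℓ ih =>
    rw [pi_norm_le_iff_of_nonneg hB0]
    intro s
    have hpos : 0 < ℓ ^ 2 := by positivity
    have hab : epochStart ℓ < epochStart ℓ + ℓ ^ 2 := by omega
    rw [hrun.v_step ℓ hℓ s]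
    set X := linAvg (epochStart ℓ) (epochStart ℓ + ℓ ^ 2) fun t => x t s with hX
    set Y := linAvg (epochStart ℓ) (epochStart ℓ + ℓ ^ 2) fun t => y t s with hY
    have hXm : X ∈ stdSimplex ℝ (Fin A) :=
      linAvg_mem (convex_stdSimplex ℝ _) hab fun t => (hrun.mem t s).1
    have hYm : Y ∈ M.tuples s := linAvg_mem (M.convex_tuples s) hab fun t => (hrun.mem t s).2
    have hYk := meanKernel_mem_kernels hN hYm.1
    have h1 := M.eval_le_eval_add hXm hYk (v ℓ) 0 s
    have h2 := M.eval_le_eval_add hXm hYk 0 (v ℓ) s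
    rw [sub_zero] at h1
    rw [zero_sub, norm_neg] at h2
    have h0 : |M.eval X (meanKernel Y) 0 s| ≤ c := by
      simp only [eval, Pi.zero_apply, mul_zero, Finset.sum_const_zero, add_zero]
      calc |∑ a, X a * M.cost s a| ≤ ∑ a, |X a * M.cost s a| := Finset.abs_sum_le_sum_abs _ _
        _ ≤ ∑ a, X a * c := by
            refine Finset.sum_le_sum fun a _ => ?_
            rw [abs_mul, abs_of_nonneg (hXm.1 a)]
            refine mul_le_mul_of_nonneg_left ?_ (hXm.1 a)
            exact (norm_le_pi_norm (M.cost s) a).trans (norm_le_pi_norm M.cost s)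
        _ = c := by rw [← Finset.sum_mul, hXm.2, one_mul]
    have h3 : M.disc * ‖v ℓ‖ ≤ M.disc * B := by gcongr
    rw [abs_le] at h0
    rw [Real.norm_eq_abs, abs_le]
    constructor <;> linarith [h0.1, h0.2]

lemma IsRun.bddAbove_stepTerm (hrun : M.IsRun v x y) (hS : 1 ≤ S) (hA : 1 ≤ A) (hN : 1 ≤ N) :
    ∃ B, ∀ ℓ, 1 ≤ ℓ → M.stepTerm (v ℓ) ≤ B := by
  obtain ⟨B, hB⟩ := hrun.exists_norm_le hN
  have := widthX_nonneg hA
  have := M.widthY_nonneg hS hN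
  have := M.disc_pos
  refine ⟨(widthX A * (Real.sqrt A * M.disc) +
    M.widthY * ((N : ℝ)⁻¹ * (Real.sqrt A)⁻¹ * M.disc)) * (Real.sqrt S * B), fun ℓ hℓ => ?_⟩
  rw [stepTerm_eq]
  gcongr
  refine (l2norm_le _).trans ?_
  gcongr
  exact hB ℓ hℓ

/-- The duality gap is at most every common bound for the gaps against single comparators. -/
lemma dualityGap_le (hS : 1 ≤ S) (hA : 1 ≤ A) (hN : 1 ≤ N) {T : ℕ} {G : ℝ}
    (h : ∀ s, ∀ x' ∈ stdSimplex ℝ (Fin A), ∀ y' ∈ M.tuples s,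
      M.saddle vstar s (outX x T s) y' -
        M.saddle vstar s x' (linAvg 0 T fun t => y t s) ≤ G) :
    M.dualityGap vstar (outX x T) (outY y T) ≤ G := by
  have : Nonempty (Fin S) := ⟨⟨0, hS⟩⟩
  refine ciSup_le fun s => ?_
  have hmem := single_mem_stdSimplex ℝ (⟨0, hA⟩ : Fin A)
  rw [sub_le_iff_le_add, M.expectedKernels_eq hN]
  refine csSup_le ⟨_, _, ⟨_, M.nominal_mem_tuples hN s, rfl⟩, rfl⟩ ?_
  rintro _ ⟨_, ⟨y', hy', rfl⟩, rfl⟩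
  rw [← sub_le_iff_le_add']
  refine le_csInf ⟨_, _, hmem, rfl⟩ ?_
  rintro _ ⟨x', hx', rfl⟩
  have := h s x' hx' y' hy'
  simp only [saddle, outY] at this ⊢
  linarith

/-- If all value vectors of the run are within `K / ℓ²` of the optimal one, the gap of the output
is `O(T^{-2/3})`: over the iterations `1, …, b`, which reach into epoch `ℓ`, the `t`-weighted gaps
sum to `O(ℓ b)`. -/
lemma IsRun.saddle_output_le (hrun : M.IsRun v x y) (hA : 1 ≤ A) (hN : 1 ≤ N)
    (hv : ∀ ℓ, 1 ≤ ℓ → v ℓ ≠ 0) {Ω K : ℝ} (hΩ0 : 0 ≤ Ω) (hK0 : 0 ≤ K)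
    (hΩ : ∀ ℓ, 1 ≤ ℓ → M.stepTerm (v ℓ) ≤ Ω)
    (hK : ∀ ℓ : ℕ, 1 ≤ ℓ → ‖v ℓ - vstar‖ ≤ K / (ℓ : ℝ) ^ 2) {T : ℕ} (hT : 1 ≤ T)
    {s : Fin S} {x' : Fin A → ℝ} {y' : Fin N → Kern S A}
    (hx' : x' ∈ stdSimplex ℝ (Fin A)) (hy' : y' ∈ M.tuples s) :
    M.saddle vstar s (outX x T s) y' - M.saddle vstar s x' (linAvg 0 T fun t => y t s) ≤
      12 * (Ω + K) * (T : ℝ) ^ (-(2 / 3) : ℝ) := by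
  set g : ℕ → ℝ := fun t => M.saddle vstar s (x t s) y' - M.saddle vstar s x' (y t s) with hg
  set κ := 2 * (Ω + K) with hκ
  have hκ0 : 0 ≤ κ := by positivity
  have hepoch : ∀ ℓ : ℕ, 1 ≤ ℓ → ∀ b, epochStart ℓ ≤ b → b ≤ epochStart (ℓ + 1) →
      ∑ t ∈ Finset.Ioc (epochStart ℓ) b, (t : ℝ) * g t ≤ κ * b := by
    intro ℓ hℓ b hab hb
    have hℓ' : 0 < (ℓ : ℝ) := by positivity
    have h1 := hrun.sum_epoch_le hA hN hℓ (hv ℓ hℓ) hx' hy' hab hb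
    have hl := M.disc_pos
    have hl1 := M.disc_lt_one
    have hgt : ∀ t, g t ≤ (M.saddle (v ℓ) s (x t s) y' - M.saddle (v ℓ) s x' (y t s)) +
        2 * (K / (ℓ : ℝ) ^ 2) := by
      intro t
      have h2 := M.saddle_le_saddle_add hN (hrun.mem t s).1 hy' vstar (v ℓ) s
      have h3 := M.saddle_le_saddle_add hN hx' (hrun.mem t s).2 (v ℓ) vstar s
      rw [norm_sub_rev] at h2
      have h4 : M.disc * ‖v ℓ - vstar‖ ≤ 1 * (K / (ℓ : ℝ) ^ 2) := by
        gcongr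
        exact hK ℓ hℓ
      simp only [hg]
      linarith
    have hw : ∑ t ∈ Finset.Ioc (epochStart ℓ) b, (t : ℝ) ≤ (ℓ : ℝ) ^ 2 * b := by
      calc ∑ t ∈ Finset.Ioc (epochStart ℓ) b, (t : ℝ)
          ≤ ∑ _t ∈ Finset.Ioc (epochStart ℓ) b, (b : ℝ) := by
            refine Finset.sum_le_sum fun t ht => ?_
            exact_mod_cast (Finset.mem_Ioc.1 ht).2
        _ = ((b - epochStart ℓ : ℕ) : ℝ) * b := by simp
        _ ≤ ((ℓ ^ 2 : ℕ) : ℝ) * b := by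
            rw [epochStart_succ hℓ] at hb
            gcongr
            omega
        _ = _ := by push_cast; rfl
    calc ∑ t ∈ Finset.Ioc (epochStart ℓ) b, (t : ℝ) * g t
        ≤ ∑ t ∈ Finset.Ioc (epochStart ℓ) b,
          ((t : ℝ) * (M.saddle (v ℓ) s (x t s) y' - M.saddle (v ℓ) s x' (y t s)) +
            (t : ℝ) * (2 * (K / (ℓ : ℝ) ^ 2))) := by
          refine Finset.sum_le_sum fun t _ => ?_
          rw [← mul_add]
          exact mul_le_mul_of_nonneg_left (hgt t) (Nat.cast_nonneg t)
      _ = ∑ t ∈ Finset.Ioc (epochStart ℓ) b,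
          (t : ℝ) * (M.saddle (v ℓ) s (x t s) y' - M.saddle (v ℓ) s x' (y t s)) +
            (∑ t ∈ Finset.Ioc (epochStart ℓ) b, (t : ℝ)) * (2 * (K / (ℓ : ℝ) ^ 2)) := by
          rw [Finset.sum_add_distrib, Finset.sum_mul]
      _ ≤ 2 * Ω * b + (ℓ : ℝ) ^ 2 * b * (2 * (K / (ℓ : ℝ) ^ 2)) := by
          gcongr
          refine h1.trans ?_
          gcongr
          exact hΩ ℓ hℓ
      _ = κ * b := by rw [hκ]; field_simp
  have hsum : ∀ ℓ : ℕ, 1 ≤ ℓ → ∀ b, epochStart ℓ ≤ b → b ≤ epochStart (ℓ + 1) →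
      ∑ t ∈ Finset.Ioc 0 b, (t : ℝ) * g t ≤ κ * ℓ * b := by
    intro ℓ hℓ
    induction ℓ, hℓ using Nat.le_induction with
    | base =>
      intro b hab hb
      have := hepoch 1 le_rfl b hab hb
      rw [epochStart_one] at this
      simpa using this
    | succ ℓ hℓ ih =>
      intro b hab hb
      have h1 := ih (epochStart (ℓ + 1)) (by rw [epochStart_succ hℓ]; omega) le_rfl
      have h2 := hepoch (ℓ + 1) (by omega) b hab hb
      rw [← Finset.sum_Ioc_consecutive _ (Nat.zero_le _) hab]
      have h3 : κ * ℓ * (epochStart (ℓ + 1) : ℝ) ≤ κ * ℓ * b := by gcongr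
      push_cast
      linarith
  obtain ⟨ℓ, hℓ, h1, h2⟩ := exists_epoch (T - 1)
  have htot := hsum ℓ hℓ T (by omega) (by omega)
  have hidx := epoch_index_le hT (show epochStart ℓ < T by omega)
  have hT0 : 0 < T := hT
  have hT' : 0 < (T : ℝ) := by exact_mod_cast hT0
  rw [← saddle_linAvg vstar s hT0 (fun t => x t s) (fun t => y t s) x' y',
    sum_Ioc_cast hT0.le] at htot
  rw [outX]
  set G := M.saddle vstar s (linAvg 0 T fun t => x t s) y' -
    M.saddle vstar s x' (linAvg 0 T fun t => y t s)
  by_cases hG : G ≤ 0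
  · exact hG.trans (by positivity)
  push Not at hG
  have hrw : (T : ℝ) * (T : ℝ) ^ (-(2 / 3) : ℝ) = (T : ℝ) ^ (1 / 3 : ℝ) := by
    nth_rewrite 1 [← Real.rpow_one (T : ℝ)]
    rw [← Real.rpow_add hT']
    norm_num
  refine le_of_mul_le_mul_left (a := (T : ℝ) ^ 2 / 2) ?_ (by positivity)
  calc (T : ℝ) ^ 2 / 2 * G ≤ ((T : ℝ) * (T + 1) - ((0 : ℕ) : ℝ) * ((0 : ℕ) + 1)) / 2 * G := by
        gcongr
        push_cast
        linarith
    _ ≤ κ * ℓ * T := htot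
    _ ≤ κ * (3 * (T : ℝ) ^ (1 / 3 : ℝ)) * T := by gcongr
    _ = (T : ℝ) ^ 2 / 2 * (12 * (Ω + K) * (T : ℝ) ^ (-(2 / 3) : ℝ)) := by
        rw [← hrw, hκ]; ring

/-- The value vectors of a run converge to the optimal one at the rate `O(ℓ⁻²)`, with a constant
proportional to `Ω`. In particular `vstar` obeys the same norm bound as the value vectors of the
run, so that the initial error `‖v 1 - vstar‖` is also controlled by `Ω`. -/
lemma IsRun.norm_value_sub_le_div_sq (hrun : M.IsRun v x y) (hS : 1 ≤ S) (hA : 1 ≤ A) (hN : 1 ≤ N)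
    (hvs : M.IsValueVector vstar) (hv : ∀ ℓ, 1 ≤ ℓ → v ℓ ≠ 0) {C : ℝ}
    (hC : ∀ (r : ℕ → ℝ) (B : ℝ), 0 ≤ B → r 1 ≤ B →
      (∀ ℓ, 1 ≤ ℓ → r (ℓ + 1) ≤ M.disc * r ℓ + B / (ℓ : ℝ) ^ 2) →
      ∀ ℓ, 1 ≤ ℓ → r ℓ ≤ C * B / (ℓ : ℝ) ^ 2)
    {Ω c : ℝ} (hΩ0 : 0 ≤ Ω) (hc : 0 < c) (hΩ : ∀ ℓ, 1 ≤ ℓ → M.stepTerm (v ℓ) ≤ Ω)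
    (hcΩ : ∀ ℓ, 1 ≤ ℓ → c * ‖v ℓ‖ ≤ Ω) (ℓ : ℕ) (hℓ : 1 ≤ ℓ) :
    ‖v ℓ - vstar‖ ≤ C * ((2 / c + 4) * Ω) / (ℓ : ℝ) ^ 2 := by
  have hrec : ∀ B, 4 * Ω ≤ B → ∀ ℓ, 1 ≤ ℓ →
      ‖v (ℓ + 1) - vstar‖ ≤ M.disc * ‖v ℓ - vstar‖ + B / (ℓ : ℝ) ^ 2 := by
    intro B hB ℓ hℓ
    refine (hrun.norm_value_sub_le hS hA hN hvs hℓ (hv ℓ hℓ)).trans ?_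
    gcongr
    linarith [hΩ ℓ hℓ]
  have hn : ∀ ℓ, 1 ≤ ℓ → ‖v ℓ‖ ≤ Ω / c := fun ℓ hℓ => by
    rw [le_div_iff₀ hc, mul_comm]; exact hcΩ ℓ hℓ
  have hlim : ‖vstar‖ ≤ Ω / c := by
    set B := ‖v 1 - vstar‖ + 4 * Ω with hB
    have hr := hC (fun ℓ => ‖v ℓ - vstar‖) B (by positivity) (by linarith)
      (hrec B (by linarith [norm_nonneg (v 1 - vstar)]))
    have hle : ∀ n : ℕ, ‖vstar‖ ≤ Ω / c + C * B * (1 / ((n : ℝ) + 1)) ^ 2 := by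
      intro n
      have h1 := hr (n + 1) (by omega)
      have h2 := hn (n + 1) (by omega)
      have h3 := norm_sub_norm_le vstar (v (n + 1))
      rw [norm_sub_rev] at h3
      push_cast at h1
      rw [one_div, inv_pow, ← div_eq_mul_inv]
      linarith
    have ht : Filter.Tendsto (fun n : ℕ => Ω / c + C * B * (1 / ((n : ℝ) + 1)) ^ 2) Filter.atTop
        (nhds (Ω / c + C * B * 0 ^ 2)) :=
      ((tendsto_one_div_add_atTop_nhds_zero_nat.pow 2).const_mul _).const_add _
    simpa using ge_of_tendsto' ht hle
  refine hC (fun ℓ => ‖v ℓ - vstar‖) ((2 / c + 4) * Ω) (by positivity) ?_ (hrec _ ?_) ℓ hℓ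
  · have h1 := norm_sub_le (v 1) vstar
    have h2 := hn 1 le_rfl
    have e : (2 / c + 4) * Ω = Ω / c + Ω / c + 4 * Ω := by ring
    linarith
  · have : 0 ≤ 2 / c * Ω := by positivity
    linarith

end Run

end Model

namespace Model

/-! ### Assembling the rate -/

section Assembly

variable {M : Model S A N} {v : ℕ → Fin S → ℝ} {x : ℕ → Fin S → Fin A → ℝ}
  {y : ℕ → Fin S → Fin N → Kern S A} {vstar : Fin S → ℝ}

/-- With a single action and either a single state or radius zero, neither player has a choice, so
the gap is not positive. -/
lemma IsRun.dualityGap_nonpos (hrun : M.IsRun v x y) (hS : 1 ≤ S) (hA : A = 1) (hN : 1 ≤ N)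
    (hdeg : S = 1 ∨ M.radius = 0) {T : ℕ} (hT : 1 ≤ T) :
    M.dualityGap vstar (outX x T) (outY y T) ≤ 0 := by
  refine dualityGap_le hS hA.ge hN fun s x' hx' y' hy' => ?_
  have hXm : outX x T s ∈ stdSimplex ℝ (Fin A) :=
    linAvg_mem (convex_stdSimplex ℝ _) hT fun t => (hrun.mem t s).1
  have hYm : (linAvg 0 T fun t => y t s) ∈ M.tuples s :=
    linAvg_mem (M.convex_tuples s) hT fun t => (hrun.mem t s).2
  have hx : outX x T s = x' := by
    subst hA
    have : Subsingleton (stdSimplex ℝ (Fin 1)) := inferInstance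
    exact congrArg Subtype.val (Subsingleton.elim (⟨_, hXm⟩ : stdSimplex ℝ (Fin 1)) ⟨x', hx'⟩)
  have hy : (linAvg 0 T fun t => y t s) = y' := by
    rcases hdeg with h | h
    · subst h
      funext i a
      have : Subsingleton (stdSimplex ℝ (Fin 1)) := inferInstance
      exact congrArg Subtype.val (Subsingleton.elim
        (⟨_, hYm.1 i a⟩ : stdSimplex ℝ (Fin 1)) ⟨_, hy'.1 i a⟩)
    · rw [M.eq_nominal_of_radius_eq_zero hN h hYm, M.eq_nominal_of_radius_eq_zero hN h hy']
  rw [hx, hy, sub_self]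

/-- A bound in terms of the supremum over all epochs gives, with twice the constant, both bounds of
the theorem: the suprema over the epochs started within `T` iterations increase to the full
supremum, so they eventually exceed half of it. -/
lemma IsRun.rate_bounds (hrun : M.IsRun v x y) (hS : 1 ≤ S) (hA : 1 ≤ A) (hN : 1 ≤ N)
    {f : ℕ → ℝ} {D : ℝ} (hD : 0 ≤ D)
    (h : ∀ T : ℕ, 1 ≤ T →
      f T ≤ D * (⨆ ℓ : {ℓ : ℕ // 1 ≤ ℓ}, M.stepTerm (v ℓ)) * (T : ℝ) ^ (-(2 / 3) : ℝ)) :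
    (∀ T : ℕ, 1 ≤ T → f T ≤ M.rate (2 * D) (⨆ ℓ : {ℓ : ℕ // 1 ≤ ℓ}, M.stepTerm (v ℓ)) T) ∧
    (∀ᶠ T : ℕ in Filter.atTop,
      f T ≤ M.rate (2 * D)
        (⨆ ℓ : {ℓ : ℕ // 1 ≤ ℓ ∧ epochStart ℓ < T}, M.stepTerm (v ℓ)) T) := by
  set Ω := ⨆ ℓ : {ℓ : ℕ // 1 ≤ ℓ}, M.stepTerm (v ℓ) with hΩ
  have hnn := fun w => M.stepTerm_nonneg hS hA hN w
  have hΩ0 : 0 ≤ Ω := Real.iSup_nonneg fun ℓ => hnn _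
  obtain ⟨B, hB⟩ := hrun.bddAbove_stepTerm hS hA hN
  have hrate : ∀ (T : ℕ) (ω : ℝ), 1 ≤ T → Ω ≤ 2 * ω → f T ≤ M.rate (2 * D) ω T := by
    intro T ω hT hω
    have hp := M.one_le_prefactor hS hA hN
    have hω0 : 0 ≤ ω := by linarith
    calc f T ≤ D * Ω * (T : ℝ) ^ (-(2 / 3) : ℝ) := h T hT
      _ ≤ D * (2 * ω) * (T : ℝ) ^ (-(2 / 3) : ℝ) := by gcongr
      _ = 1 * (2 * D * ω * (T : ℝ) ^ (-(2 / 3) : ℝ)) := by ring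
      _ ≤ (Real.sqrt S / Real.sqrt N * RX A * M.RY) *
          (2 * D * ω * (T : ℝ) ^ (-(2 / 3) : ℝ)) := by gcongr
      _ = M.rate (2 * D) ω T := by unfold rate; ring
  refine ⟨fun T hT => hrate T Ω hT (by linarith), ?_⟩
  rcases hΩ0.eq_or_lt with h0 | hpos
  · filter_upwards [Filter.eventually_ge_atTop 1] with T hT
    refine hrate T _ hT ?_
    rw [← h0]
    have : 0 ≤ ⨆ ℓ : {ℓ : ℕ // 1 ≤ ℓ ∧ epochStart ℓ < T}, M.stepTerm (v ℓ) :=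
      Real.iSup_nonneg fun ℓ => hnn _
    linarith
  · have : Nonempty {ℓ : ℕ // 1 ≤ ℓ} := ⟨⟨1, le_rfl⟩⟩
    obtain ⟨⟨ℓ, hℓ⟩, hlt⟩ := exists_lt_of_lt_ciSup (show Ω / 2 < Ω by linarith)
    filter_upwards [Filter.eventually_gt_atTop (epochStart ℓ)] with T hT
    refine hrate T _ (by omega) ?_
    have hbdd : BddAbove (Set.range fun ℓ : {ℓ : ℕ // 1 ≤ ℓ ∧ epochStart ℓ < T} =>
        M.stepTerm (v ℓ)) := ⟨B, by rintro _ ⟨ℓ, rfl⟩; exact hB _ ℓ.2.1⟩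
    have := le_ciSup hbdd ⟨ℓ, hℓ, hT⟩
    simp only at this hlt
    linarith

/-- The rate in terms of the supremum of `Θ_X / τ + Θ_Y / σ` over all epochs, when this quantity
dominates `c ‖v‖`. -/
lemma IsRun.dualityGap_le_rate (hrun : M.IsRun v x y) (hS : 1 ≤ S) (hA : 1 ≤ A) (hN : 1 ≤ N)
    (hvs : M.IsValueVector vstar) (hv : ∀ ℓ, 1 ≤ ℓ → v ℓ ≠ 0) {C : ℝ} (hC0 : 0 ≤ C)
    (hC : ∀ (r : ℕ → ℝ) (B : ℝ), 0 ≤ B → r 1 ≤ B →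
      (∀ ℓ, 1 ≤ ℓ → r (ℓ + 1) ≤ M.disc * r ℓ + B / (ℓ : ℝ) ^ 2) →
      ∀ ℓ, 1 ≤ ℓ → r ℓ ≤ C * B / (ℓ : ℝ) ^ 2)
    {c : ℝ} (hc : 0 < c) (hcv : ∀ w : Fin S → ℝ, c * ‖w‖ ≤ M.stepTerm w) {T : ℕ} (hT : 1 ≤ T) :
    M.dualityGap vstar (outX x T) (outY y T) ≤
      12 * (1 + C * (2 / c + 4)) * (⨆ ℓ : {ℓ : ℕ // 1 ≤ ℓ}, M.stepTerm (v ℓ)) *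
        (T : ℝ) ^ (-(2 / 3) : ℝ) := by
  set Ω := ⨆ ℓ : {ℓ : ℕ // 1 ≤ ℓ}, M.stepTerm (v ℓ) with hΩdef
  have hΩ0 : 0 ≤ Ω := Real.iSup_nonneg fun ℓ => M.stepTerm_nonneg hS hA hN _
  obtain ⟨B, hB⟩ := hrun.bddAbove_stepTerm hS hA hN
  have hΩ : ∀ ℓ, 1 ≤ ℓ → M.stepTerm (v ℓ) ≤ Ω := fun ℓ hℓ =>
    le_ciSup (f := fun ℓ : {ℓ : ℕ // 1 ≤ ℓ} => M.stepTerm (v ℓ))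
      ⟨B, by rintro _ ⟨ℓ, rfl⟩; exact hB _ ℓ.2⟩ ⟨ℓ, hℓ⟩
  have hK := hrun.norm_value_sub_le_div_sq hS hA hN hvs hv hC hΩ0 hc hΩ
    fun ℓ hℓ => (hcv _).trans (hΩ ℓ hℓ)
  refine dualityGap_le hS hA hN fun s x' hx' y' hy' => ?_
  refine (hrun.saddle_output_le hA hN hv hΩ0 (by positivity) hΩ hK hT hx' hy').trans_eq ?_
  ring

end Assembly

end Model

end WDRMDP

end

open WDRMDP Model in
/-- The constant depends on the discount factor only (if there is a single action, on the discount
factor and the radius). The first bound holds for all `T ≥ 1`, with the supremum of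
`Θ_X/τ + Θ_Y/σ` over all epochs; the second one for all large `T`, with the supremum over the
epochs that have been started within `T` iterations. -/
theorem theorem1 (disc : ℝ) (hdisc0 : 0 < disc) (hdisc1 : disc < 1) :
    ∃ (C₀ : ℝ) (C₁ : ℝ → ℝ),
      ∀ (S A N : ℕ), 1 ≤ S → 1 ≤ A → 1 ≤ N →
      ∀ M : WDRMDP.Model S A N, M.disc = disc →
      ∀ vstar : Fin S → ℝ, M.IsValueVector vstar →
      ∀ (v : ℕ → Fin S → ℝ) (x : ℕ → Fin S → Fin A → ℝ)
        (y : ℕ → Fin S → Fin N → WDRMDP.Kern S A),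
      M.IsRun v x y → (∀ ℓ, 1 ≤ ℓ → v ℓ ≠ 0) →
        (∀ T : ℕ, 1 ≤ T →
          M.dualityGap vstar (WDRMDP.Model.outX x T) (WDRMDP.Model.outY y T) ≤
            M.rate (if 2 ≤ A then C₀ else C₁ M.radius)
              (⨆ ℓ : {ℓ : ℕ // 1 ≤ ℓ}, M.stepTerm (v ℓ)) T) ∧
        (∀ᶠ T : ℕ in Filter.atTop,
          M.dualityGap vstar (WDRMDP.Model.outX x T) (WDRMDP.Model.outY y T) ≤
            M.rate (if 2 ≤ A then C₀ else C₁ M.radius)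
              (⨆ ℓ : {ℓ : ℕ // 1 ≤ ℓ ∧ WDRMDP.epochStart ℓ < T}, M.stepTerm (v ℓ)) T) := by
  obtain ⟨C, hC0, hC⟩ := exists_recursion_constant hdisc0 hdisc1
  -- `D c` is the constant for a run in which `Θ_X/τ + Θ_Y/σ` dominates `c ‖v‖`. For a single action
  -- and radius zero, `c = 0` and `2 / c = 0`; then the gap is not positive and `0 ≤ D c` suffices.
  set D : ℝ → ℝ := fun c => 12 * (1 + C * (2 / c + 4)) with hD
  have hD0 : ∀ c, 0 ≤ c → 0 ≤ D c := fun c hc => by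
    simp only [hD]
    positivity
  refine ⟨2 * D disc, fun θ => 2 * D (disc * (min 1 (θ / 2) ^ 2 / 8)), ?_⟩
  intro S A N hS hA hN M hM vstar hvs v x y hrun hv
  subst hM
  split_ifs with hA2
  · exact hrun.rate_bounds hS hA hN (hD0 _ hdisc0.le) fun T hT =>
      hrun.dualityGap_le_rate hS hA hN hvs hv hC0 hC hdisc0
        (fun w => M.disc_mul_norm_le_stepTerm hS hA2 hN w) hT
  · have hA1 : A = 1 := by omega
    refine hrun.rate_bounds hS hA hN (hD0 _ (by positivity)) fun T hT => ?_
    by_cases hdeg : S = 1 ∨ M.radius = 0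
    · refine (hrun.dualityGap_nonpos hS hA1 hN hdeg hT).trans ?_
      have h1 := hD0 (M.disc * (min 1 (M.radius / 2) ^ 2 / 8)) (by positivity)
      have h2 : 0 ≤ ⨆ ℓ : {ℓ : ℕ // 1 ≤ ℓ}, M.stepTerm (v ℓ) :=
        Real.iSup_nonneg fun ℓ => M.stepTerm_nonneg hS hA hN _
      positivity
    · push Not at hdeg
      have hθ : 0 < M.radius := lt_of_le_of_ne M.radius_nonneg (Ne.symm hdeg.2)
      have hmin : 0 < min 1 (M.radius / 2) := lt_min one_pos (by positivity)
      exact hrun.dualityGap_le_rate hS hA hN hvs hv hC0 hC (by positivity)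
        (fun w => M.radius_mul_norm_le_stepTerm hA1 (by omega) hN w) hT
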